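/- **Conventions.** All functions are complex valued. A quasi-Banach space is a complex vector space $X$ with a quasi-norm $\|\cdot\|_X$ for which it is complete. For $x\in X$ and $\emptyset\ne A\subseteq X$ put $E(x,A)=\inf_{a\in A}\|x-a\|_X$. An *approximation scheme* in $X$ is a chain $A_0\subsetneq A_1\subsetneq A_2\subsetneq\cdots$ of subsets of $X$ such that (i) there is $K:\mathbb N\to\mathbb N$ with $K(n)\ge n$ and $A_n+A_n\subseteq A_{K(n)}$ for all $n$; (ii) $\lambda A_n\subseteq A_n$ for all $n$ and all scalars $\lambda$; (iii) $\bigcup_n A_n$ is dense in $X$. A sequence $(A_n)$ of subsets of $X$ *satisfies Shapiro's Theorem* in $X$ if for every non-increasing sequence $\varepsilon_n\to 0$ there is $x\in X$ with $E(x,A_n)\ne O(\varepsilon_n)$. For a set $\Omega\subseteq\mathbb C$, $R_n(\Omega)$ is the set of functions $p/q$ on $\Omega$, where $p,q$ are complex polynomials of degree $\le n$ and $q$ has no zero in $\Omega$. For an interval $I\subseteq\mathbb R$ or $I=\mathbb T=\mathbb R/2\pi\mathbb Z$, $E_n(I)$ is the set of functions $t\mapsto p(e^{it})/q(e^{it})$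 on $I$, where $p(z)=\sum_{k=-n}^n a_kz^k$, $q(z)=\sum_{k=-n}^n b_kz^k$ with complex coefficients, and $q(e^{it})\neq0$ for all $t\in I$. $C_0(I)$ is the space of continuous functions on $I$ vanishing at infinity (the sup-norm closure of the continuous functions with compact support in $I$); $L_p(I)$ refers to Lebesgue measure, $L_p(\partial\mathbb D)$ to arc length. $A$ is the disk algebra and $H_p$ the Hardy space of the unit disk $\mathbb D$, both regarded as spaces of holomorphic functions on $\mathbb D$. An inclusion of $X$ in $L_p$ or $H_p$ means that $X$ is a linear subspace and that the inclusion map is continuous. Intervals are assumed to have non-empty interior. **Theorem.** Let $0<p<\infty$. 1. Let $I$ be a real interval and $X$ a quasi-Banach space with $C_0(I)\subseteq X\subseteq L_p(I)$ and $C_0(I)$ dense in $X$. Put $A_n=R_n(I)\cap X$ (which is $R_n(I)$ if $I$ is compact). Then $(A_n)_{n\ge0}$ satisfies Shapiro's Theorem in $X$, $(A_n)_{n\ge1}$ is an approximation scheme in $X$, and so is $(A_n)_{n\ge0}$ if $I$ is not open. 2. Let $I$ and $X$ be as in 1, and put $A_n=E_n(I)\cap X$ (which is $E_n(I)$ if $I$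 is compact). Then $(A_n)_{n\ge0}$ satisfies Shapiro's Theorem in $X$. It is an approximation scheme in $X$ if, for some $a\in\mathbb R$, $I\subseteq[a,a+2\pi]$ and the functions $f\in C_0(I)$ which, extended by $0$ outside $I$, satisfy $f(a)=f(a+2\pi)$ are dense in $X$. (The density is automatic if $I\subseteq(a,a+2\pi)$.) 3. Let $X$ be a quasi-Banach space with $C(\mathbb T)\subseteq X\subseteq L_p(\mathbb T)$ and $C(\mathbb T)$ dense in $X$. Then $(E_n(\mathbb T))_{n\ge0}$ is an approximation scheme in $X$ and satisfies Shapiro's Theorem. 4. Let $X$ be a quasi-Banach space with $C(\partial\mathbb D)\subseteq X\subseteq L_p(\partial\mathbb D)$ and $C(\partial\mathbb D)$ dense in $X$. Then $(R_n(\partial\mathbb D))_{n\ge0}$ is an approximation scheme in $X$ and satisfies Shapiro's Theorem. 5. Let $X$ be a quasi-Banach space with $A\subseteq X\subseteq H_p$ and $A$ dense in $X$. Then $(R_n(\overline{\mathbb D}))_{n\ge0}$ is an approximation scheme in $X$ and satisfies Shapiro's Theorem. -/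

import Mathlib

open MeasureTheory Filter Topology Polynomial

noncomputable section

instance fact_two_pi_pos : Fact ((0 : ℝ) < 2 * Real.pi) := ⟨Real.two_pi_pos⟩

/-! ### Quasi-Banach spaces, approximation schemes, Shapiro's Theorem -/

section Abstract

variable {V : Type*} [AddCommGroup V] [Module ℂ V]

/-- `N` is a quasi-norm on the complex vector space `V`. -/
structure IsQuasiNorm (N : V → ℝ) : Prop where
  nonneg : ∀ x, 0 ≤ N x
  eq_zero_iff : ∀ x, N x = 0 ↔ x = 0
  smul : ∀ (c : ℂ) (x : V), N (c • x) = ‖c‖ * N x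
  add_le : ∃ κ : ℝ, ∀ x y, N (x + y) ≤ κ * (N x + N y)

/-- `(V, N)` is a quasi-Banach space: a quasi-norm for which every Cauchy sequence converges. -/
structure IsQuasiBanach (N : V → ℝ) : Prop extends IsQuasiNorm N where
  complete : ∀ u : ℕ → V,
    (∀ ε > 0, ∃ M : ℕ, ∀ m ≥ M, ∀ n ≥ M, N (u m - u n) < ε) →
    ∃ x : V, Tendsto (fun n => N (u n - x)) atTop (𝓝 0)

/-- The error of best approximation `E(x, A) = inf_{a ∈ A} N (x - a)`. -/
def bestError (N : V → ℝ) (x : V) (A : Set V) : ℝ := ⨅ a : A, N (x - a)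

/-- Approximation scheme: a strictly increasing chain `A 0 ⊂ A 1 ⊂ ⋯` of subsets which is closed
under scalar multiples, satisfies `A n + A n ⊆ A (K n)` with some `K n ≥ n`, and has dense union. -/
structure IsApproximationScheme (N : V → ℝ) (A : ℕ → Set V) : Prop where
  strict : ∀ n, A n ⊂ A (n + 1)
  add_subset : ∃ K : ℕ → ℕ, ∀ n, n ≤ K n ∧ ∀ x ∈ A n, ∀ y ∈ A n, x + y ∈ A (K n)
  smul_mem : ∀ n, ∀ c : ℂ, ∀ x ∈ A n, c • x ∈ A n
  dense : ∀ x : V, ∀ ε > 0, ∃ n, ∃ a ∈ A n, N (x - a) < ε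

/-- `(V, A)` satisfies Shapiro's Theorem: for every non-increasing null sequence `ε` there is an
`x` whose errors of best approximation `E(x, A n)` are not `O(ε n)`. -/
def SatisfiesShapiro (N : V → ℝ) (A : ℕ → Set V) : Prop :=
  ∀ ε : ℕ → ℝ, Antitone ε → Tendsto ε atTop (𝓝 0) →
    ∃ x : V, ¬ ((fun n => bestError N x (A n)) =O[atTop] ε)

end Abstract

/-! ### Algebraic and trigonometric rational functions -/

/-- Rational functions of degree `n` on a set `T` whose points `t` have the coordinate `z t ∈ ℂ`:
quotients `p / q` of complex polynomials of degree at most `n` such that `q` has no zero on the set.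
For `T = Ω ⊆ ℂ` and the inclusion `z`, this is `R_n(Ω)`. -/
def ratFunctions {T : Type*} (z : T → ℂ) (n : ℕ) : Set (T → ℂ) :=
  {f | ∃ p q : ℂ[X], p.natDegree ≤ n ∧ q.natDegree ≤ n ∧
    (∀ t, q.eval (z t) ≠ 0) ∧ ∀ t, f t = p.eval (z t) / q.eval (z t)}

/-- The inclusion of a set of real numbers into `ℂ`. -/
def realCoord (I : Set ℝ) (t : I) : ℂ := ((t : ℝ) : ℂ)

/-- Trigonometric rational functions of degree `n` on a parameter set `T`, where `e : T → ℂ` is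
`t ↦ e^{it}`: quotients `p(e^{it}) / q(e^{it})` with `p(z) = ∑_{k=-n}^n a_k z^k`,
`q(z) = ∑_{k=-n}^n b_k z^k` and `q(e^{it}) ≠ 0` on `T`. -/
def trigRatFunctions {T : Type*} (e : T → ℂ) (n : ℕ) : Set (T → ℂ) :=
  {f | ∃ a b : ℤ → ℂ,
    (∀ t, ∑ k ∈ Finset.Icc (-(n : ℤ)) n, b k * e t ^ k ≠ 0) ∧
    ∀ t, f t = (∑ k ∈ Finset.Icc (-(n : ℤ)) n, a k * e t ^ k) /
      (∑ k ∈ Finset.Icc (-(n : ℤ)) n, b k * e t ^ k)}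

/-- `t ↦ e^{it}` on a set of real numbers. -/
def realExp (I : Set ℝ) (t : I) : ℂ := Complex.exp (Complex.I * ((t : ℝ) : ℂ))

/-- `t ↦ e^{it}` on `𝕋 = ℝ / 2πℤ`. -/
def torusExp (t : AddCircle (2 * Real.pi)) : ℂ := (AddCircle.toCircle t : ℂ)

/-! ### Spaces between `C₀` and `L_p` -/

/-- `(X, N)` is a quasi-Banach space of (classes of) functions with `C₀(Ω) ⊆ X ⊆ L_p(μ)`, the second
inclusion being continuous, in which `C₀(Ω)` is dense. When `Ω` is compact, `C₀(Ω) = C(Ω)`. -/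
structure IsBetweenC0AndLp {Ω : Type*} [TopologicalSpace Ω] [MeasurableSpace Ω] (μ : Measure Ω)
    (p : ℝ) (X : Submodule ℂ (Ω →ₘ[μ] ℂ)) (N : X → ℝ) : Prop where
  quasiBanach : IsQuasiBanach N
  subset_Lp : ∃ C : ℝ, ∀ x : X,
    eLpNorm (x : Ω →ₘ[μ] ℂ) (ENNReal.ofReal p) μ ≤ ENNReal.ofReal (C * N x)
  C0_subset : ∀ f : ZeroAtInftyContinuousMap Ω ℂ, ∃ x : X, (x : Ω →ₘ[μ] ℂ) =ᵐ[μ] f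
  C0_dense : ∀ x : X, ∀ ε > 0, ∃ (f : ZeroAtInftyContinuousMap Ω ℂ) (y : X),
    (y : Ω →ₘ[μ] ℂ) =ᵐ[μ] f ∧ N (x - y) < ε

/-- The set of the elements of `X` which coincide almost everywhere with a function from `F`. -/
def elementsIn {Ω : Type*} [MeasurableSpace Ω] {μ : Measure Ω}
    (X : Submodule ℂ (Ω →ₘ[μ] ℂ)) (F : Set (Ω → ℂ)) : Set X :=
  {x | ∃ f ∈ F, (x : Ω →ₘ[μ] ℂ) =ᵐ[μ] f}

/-- Lebesgue measure on a set of real numbers. -/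
def lebesgueOn (I : Set ℝ) : Measure I := Measure.comap Subtype.val volume

/-- The unit circle `∂𝔻`. -/
abbrev UnitCircle : Set ℂ := Metric.sphere (0 : ℂ) 1

/-- The parametrization `t ↦ e^{it}` of the unit circle by `𝕋`. -/
def torusToCircle (t : AddCircle (2 * Real.pi)) : UnitCircle :=
  ⟨torusExp t, mem_sphere_zero_iff_norm.mpr (Circle.norm_coe _)⟩

/-- The length measure on the unit circle. -/
def arcLength : Measure UnitCircle := Measure.map torusToCircle volume

/-! ### Spaces between the disk algebra and `H_p` -/

/-- The open unit disk `𝔻`. -/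
abbrev OpenDisk : Set ℂ := Metric.ball (0 : ℂ) 1

/-- The disk algebra, as a set of functions on `𝔻`: those which have an extension that is
holomorphic on `𝔻` and continuous on the closed disk. -/
def diskAlgebra : Set (OpenDisk → ℂ) :=
  {f | ∃ F : ℂ → ℂ, DiffContOnCl ℂ F OpenDisk ∧ ∀ z : OpenDisk, f z = F z}

/-- `f : 𝔻 → ℂ` is holomorphic. -/
def IsHolomorphicOnDisk (f : OpenDisk → ℂ) : Prop :=
  DifferentiableOn ℂ (Function.extend Subtype.val f 0) OpenDisk

/-- The `H_p` (quasi-)norm `sup_{0 ≤ r < 1} ((2π)⁻¹ ∫_0^{2π} |f(r e^{iθ})|^p dθ)^{1/p}`. -/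
def hardyNorm (p : ℝ) (f : OpenDisk → ℂ) : ENNReal :=
  ⨆ r ∈ Set.Ico (0 : ℝ) 1, (ENNReal.ofReal (2 * Real.pi)⁻¹ *
    ∫⁻ θ in Set.Ioc 0 (2 * Real.pi),
      ‖Function.extend Subtype.val f 0 (circleMap 0 r θ)‖ₑ ^ p) ^ (1 / p)

/-- `(X, N)` is a quasi-Banach space of holomorphic functions on `𝔻` with `A ⊆ X ⊆ H_p`, the second
inclusion being continuous, in which the disk algebra `A` is dense. -/
structure IsBetweenDiskAlgebraAndHp (p : ℝ) (X : Submodule ℂ (OpenDisk → ℂ)) (N : X → ℝ) :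
    Prop where
  quasiBanach : IsQuasiBanach N
  holomorphic : ∀ x : X, IsHolomorphicOnDisk x
  subset_Hp : ∃ C : ℝ, ∀ x : X, hardyNorm p x ≤ ENNReal.ofReal (C * N x)
  diskAlgebra_subset : ∀ f ∈ diskAlgebra, f ∈ X
  diskAlgebra_dense : ∀ x : X, ∀ ε > 0, ∃ y : X, (y : OpenDisk → ℂ) ∈ diskAlgebra ∧ N (x - y) < ε

/-- The elements of `X` given by a function from `R_n` of the closed unit disk. -/
def diskRatElements (X : Submodule ℂ (OpenDisk → ℂ)) (n : ℕ) : Set X :=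
  {x | ∃ g ∈ ratFunctions (Subtype.val : Metric.closedBall (0 : ℂ) 1 → ℂ) n,
    ∀ z : OpenDisk, (x : OpenDisk → ℂ) z = g ⟨z, Metric.ball_subset_closedBall z.2⟩}

end

/-!
All five parts rest on two applications of Baire's theorem in a *Banach* space `B` of continuous
functions (`C₀(Ω)`, or the disk algebra with the supremum norm), never in the quasi-Banach space `X`
itself.

* The inclusion `B → X` has a closed graph, because convergence in `L_p` or `H_p` determines a limit
  almost everywhere. Hence it is bounded (`exists_bound_of_closed_graph`), and uniform approximation
  in `B` gives approximation in `X`. In particular `X` cannot exist over an unbounded interval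
  (`IsBetweenC0AndLp.bounded`).
* If Shapiro's Theorem failed, the errors of best approximation by `A n` would tend to `0` uniformly
  on the unit ball of `B` (`satisfiesShapiro_of_bound`). So it suffices to find, for each `n`, a
  continuous function of norm at most one whose distance from `A n` in `L_p` is at least a fixed
  constant.

Such functions oscillate. On the line and on the circle the conjugate of a polynomial is, up to a
factor without zeros, a polynomial, and so the real part of a rational function of degree `n` either
vanishes identically or has at most `2n` zeros (`re_ratFunction_zeros`). On each period free of
zeros, a sine wave has the wrong sign on one half, and a wave with `4n + 1` periods differs from the
rational function by at least `1/2` on a set of measure bounded below (`volume_far_from_sine`). In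
the disk the wave is the boundary value of `-i w ^ (4n + 1)`, and the circle is replaced by
a slightly smaller one. Trigonometric rational functions of degree `n` are algebraic rational
functions of degree `2n` in `e^{it}` (`trigRatFunctions_eq`).

For approximation schemes, the chain is strict because of a function in lowest terms with a pole of
maximal order (`ne_of_mem_ratFunctions`), whose numerator is chosen to vanish at the end points
missing from the interval. Density follows from Weierstrass' theorems, or from Taylor expansion of
a dilated function in the disk. On intervals, an affine function of the coordinate is subtracted so
that approximants also vanish at the missing end points (`exists_C0_near_of_approx`).
-/

noncomputable section

/-! ### Quasi-norms: closed graphs and Shapiro's Theorem -/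

section QuasiNorm

variable {V : Type*} [AddCommGroup V] [Module ℂ V] {N : V → ℝ}

theorem IsQuasiNorm.map_zero (hN : IsQuasiNorm N) : N 0 = 0 := (hN.eq_zero_iff 0).2 rfl

theorem IsQuasiNorm.map_neg (hN : IsQuasiNorm N) (x : V) : N (-x) = N x := by
  simpa using hN.smul (-1) x

theorem IsQuasiNorm.map_sub_comm (hN : IsQuasiNorm N) (x y : V) : N (x - y) = N (y - x) := by
  rw [← hN.map_neg, neg_sub]

theorem IsQuasiNorm.exists_one_le (hN : IsQuasiNorm N) :
    ∃ κ : ℝ, 1 ≤ κ ∧ ∀ x y, N (x + y) ≤ κ * (N x + N y) := by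
  obtain ⟨κ, h⟩ := hN.add_le
  refine ⟨max κ 1, le_max_right _ _, fun x y => (h x y).trans ?_⟩
  exact mul_le_mul_of_nonneg_right (le_max_left _ _) (add_nonneg (hN.nonneg x) (hN.nonneg y))

theorem sub_le_of_add_le_mul {V : Type*} [AddCommGroup V] {N : V → ℝ} {κ : ℝ}
    (hadd : ∀ x y, N (x + y) ≤ κ * (N x + N y)) (x y z : V) :
    N (x - z) ≤ κ * (N (x - y) + N (y - z)) := by
  simpa using hadd (x - y) (y - z)

theorem quasiNorm_map_sub_le {B : Type*} [NormedAddCommGroup B] [NormedSpace ℂ B]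
    {j : B →ₗ[ℂ] V} {C : ℝ} (hC : ∀ b, N (j b) ≤ C * ‖b‖) (f g : B) :
    N (j f - j g) ≤ C * ‖f - g‖ := by
  rw [← map_sub]; exact hC _

/-- In a space whose quasi-norm has modulus of concavity `κ`, sums of terms that decay like
`(2κ)⁻ⁿ` are controlled by their first term. -/
theorem quasiNorm_sum_le_of_geometric (hN : IsQuasiNorm N) {κ : ℝ} (hκ : 1 ≤ κ)
    (hadd : ∀ x y, N (x + y) ≤ κ * (N x + N y)) {D : ℝ} (hD : 0 ≤ D) {v : ℕ → V}
    (hv : ∀ n, N (v n) ≤ D * (1 / (2 * κ)) ^ n) (L n : ℕ) :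
    N (∑ i ∈ Finset.range L, v (n + i)) ≤ 2 * κ * D * (1 / (2 * κ)) ^ n := by
  have hκ0 : 0 < κ := by linarith
  induction L generalizing n with
  | zero => simp only [Finset.range_zero, Finset.sum_empty, hN.map_zero]; positivity
  | succ L ih =>
    rw [Finset.sum_range_succ']
    have h1 := ih (n + 1)
    have h2 := hv n
    have h3 := hadd (∑ i ∈ Finset.range L, v (n + (i + 1))) (v (n + 0))
    have h4 : ∑ i ∈ Finset.range L, v (n + (i + 1)) = ∑ i ∈ Finset.range L, v (n + 1 + i) :=
      Finset.sum_congr rfl fun i _ => by rw [add_right_comm, add_assoc]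
    rw [h4] at h3 ⊢
    refine h3.trans ?_
    rw [add_zero]
    calc κ * (N (∑ i ∈ Finset.range L, v (n + 1 + i)) + N (v n))
        ≤ κ * (2 * κ * D * (1 / (2 * κ)) ^ (n + 1) + D * (1 / (2 * κ)) ^ n) := by gcongr
      _ = 2 * κ * D * (1 / (2 * κ)) ^ n := by rw [pow_succ]; field_simp; ring

/-- A Baire category argument: if a Banach space is the union of an increasing family of sets
`Γ k`, then some `Γ k` has differences that are dense in a ball around the origin. -/
theorem exists_ball_subset_closure_sub {B : Type*} [NormedAddCommGroup B] [CompleteSpace B]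
    {Γ : ℕ → Set B} (hΓ : ∀ b, ∃ k, b ∈ Γ k) :
    ∃ k, ∃ r > 0, ∀ b : B, ‖b‖ < r → ∀ δ > 0, ∃ y₁ ∈ Γ k, ∃ y₂ ∈ Γ k, ‖b - (y₁ - y₂)‖ < δ := by
  obtain ⟨k, b₀, hb₀⟩ := nonempty_interior_of_iUnion_of_closed
    (f := fun k => closure (Γ k)) (fun k => isClosed_closure)
    (Set.eq_univ_of_forall fun b => by
      obtain ⟨k, hk⟩ := hΓ b
      exact Set.mem_iUnion.2 ⟨k, subset_closure hk⟩)
  obtain ⟨r, hr, hball⟩ := Metric.mem_nhds_iff.1 (mem_interior_iff_mem_nhds.1 hb₀)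
  refine ⟨k, r, hr, fun b hb δ hδ => ?_⟩
  have h1 : b₀ + b ∈ closure (Γ k) := hball (by simpa [dist_eq_norm] using hb)
  have h2 : b₀ ∈ closure (Γ k) := hball (Metric.mem_ball_self hr)
  obtain ⟨y₁, hy₁, h1⟩ := Metric.mem_closure_iff.1 h1 (δ / 2) (by positivity)
  obtain ⟨y₂, hy₂, h2⟩ := Metric.mem_closure_iff.1 h2 (δ / 2) (by positivity)
  refine ⟨y₁, hy₁, y₂, hy₂, ?_⟩
  rw [dist_eq_norm] at h1 h2
  calc ‖b - (y₁ - y₂)‖ = ‖(b₀ + b - y₁) - (b₀ - y₂)‖ := by congr 1; abel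
    _ ≤ ‖b₀ + b - y₁‖ + ‖b₀ - y₂‖ := norm_sub_le _ _
    _ < δ := by linarith

variable {B : Type*} [NormedAddCommGroup B] [NormedSpace ℂ B] [CompleteSpace B]

/-- Closed graph theorem for a linear map from a Banach space to a quasi-Banach space. -/
theorem exists_bound_of_closed_graph (hN : IsQuasiBanach N) (j : B →ₗ[ℂ] V)
    (hj : ∀ (u : ℕ → B) (b : B) (x : V), Tendsto u atTop (𝓝 b) →
      Tendsto (fun n => N (j (u n) - x)) atTop (𝓝 0) → j b = x) :
    ∃ C > 0, ∀ b, N (j b) ≤ C * ‖b‖ := by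
  have hN' := hN.toIsQuasiNorm
  obtain ⟨κ, hκ, hadd⟩ := hN'.exists_one_le
  have hκ0 : 0 < κ := by linarith
  obtain ⟨k, r, hr, hk⟩ := exists_ball_subset_closure_sub (Γ := fun k : ℕ => {b : B | N (j b) ≤ k})
    (fun b => exists_nat_ge (N (j b)))
  -- every `b` has arbitrarily good approximations `y` with `N (j y) ≤ M ‖b‖`
  have approx : ∀ b : B, ∀ δ > 0, ∃ y : B, ‖b - y‖ ≤ δ ∧
      N (j y) ≤ (2 * κ * k * (2 / r)) * ‖b‖ := by
    intro b δ hδ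
    rcases eq_or_ne b 0 with rfl | hb
    · exact ⟨0, by simpa using hδ.le, by simp [hN'.map_zero]⟩
    have hb' : 0 < ‖b‖ := norm_pos_iff.2 hb
    set s : ℝ := r / 2 / ‖b‖ with hs
    have hs0 : 0 < s := by positivity
    have hsn : ‖(s : ℂ)‖ = s := by simp [abs_of_pos hs0]
    obtain ⟨y₁, hy₁, y₂, hy₂, h⟩ := hk ((s : ℂ) • b) (by
      rw [norm_smul, hsn, hs, div_mul_cancel₀ _ hb'.ne']; linarith) (s * δ) (by positivity)
    have hsc : (s : ℂ) ≠ 0 := by exact_mod_cast hs0.ne'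
    refine ⟨(s : ℂ)⁻¹ • (y₁ - y₂), ?_, ?_⟩
    · have : b - (s : ℂ)⁻¹ • (y₁ - y₂) = (s : ℂ)⁻¹ • ((s : ℂ) • b - (y₁ - y₂)) := by
        rw [smul_sub _ ((s : ℂ) • b), inv_smul_smul₀ hsc]
      rw [this, norm_smul, norm_inv, hsn, inv_mul_le_iff₀ hs0]
      exact h.le
    · rw [map_smul, hN'.smul, norm_inv, hsn, map_sub]
      have h1 : N (j y₁ - j y₂) ≤ 2 * κ * k := by
        have := hadd (j y₁) (-j y₂)
        rw [← sub_eq_add_neg, hN'.map_neg] at this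
        refine this.trans ?_
        have h1 : N (j y₁) ≤ k := hy₁
        have h2 : N (j y₂) ≤ k := hy₂
        nlinarith
      calc s⁻¹ * N (j y₁ - j y₂) ≤ s⁻¹ * (2 * κ * k) := by gcongr
        _ = _ := by rw [hs]; field_simp
  set M : ℝ := 2 * κ * k * (2 / r) with hM
  have hM0 : 0 ≤ M := by positivity
  refine ⟨2 * κ ^ 2 * M + 1, by positivity, fun b => ?_⟩
  rcases eq_or_ne b 0 with rfl | hb
  · simp [hN'.map_zero]
  have hb' : 0 < ‖b‖ := norm_pos_iff.2 hb
  set θ : ℝ := 1 / (2 * κ) with hθ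
  have hθ0 : 0 < θ := by positivity
  have hθ1 : θ < 1 := by rw [hθ, div_lt_one (by positivity)]; linarith
  choose! g hg using fun (n : ℕ) (b' : B) => approx b' (θ ^ (n + 1) * ‖b‖) (by positivity)
  -- `R n` is the remainder after `n` steps of successive approximation
  let R : ℕ → B := fun n => Nat.rec b (fun n c => c - g n c) n
  have hR0 : R 0 = b := rfl
  have hRs : ∀ n, R (n + 1) = R n - g n (R n) := fun n => rfl
  have hRn : ∀ n, ‖R n‖ ≤ θ ^ n * ‖b‖ := by
    intro n
    cases n with
    | zero => simp [hR0]
    | succ n => rw [hRs]; exact (hg n (R n)).1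
  set v : ℕ → V := fun n => j (g n (R n)) with hv
  have hvn : ∀ n, N (v n) ≤ (M * ‖b‖) * θ ^ n := fun n => by
    refine (hg n (R n)).2.trans ?_
    calc M * ‖R n‖ ≤ M * (θ ^ n * ‖b‖) := by gcongr; exact hRn n
      _ = _ := by ring
  have hsum : ∀ n, ∑ i ∈ Finset.range n, v i = j (b - R n) := by
    intro n
    induction n with
    | zero => simp [hR0]
    | succ n ih =>
      rw [Finset.sum_range_succ, ih, hRs, hv, ← map_add]
      congr 1; abel
  have key := quasiNorm_sum_le_of_geometric hN' hκ hadd (D := M * ‖b‖) (by positivity) hvn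
  have hpow : Tendsto (fun n : ℕ => 2 * κ * (M * ‖b‖) * θ ^ n) atTop (𝓝 0) := by
    simpa using (tendsto_pow_atTop_nhds_zero_of_lt_one hθ0.le hθ1).const_mul (2 * κ * (M * ‖b‖))
  have hle : ∀ n m, n ≤ m → N (j (b - R m) - j (b - R n)) ≤ 2 * κ * (M * ‖b‖) * θ ^ n := by
    intro n m hnm
    obtain ⟨L, rfl⟩ := Nat.exists_eq_add_of_le hnm
    rw [← hsum, ← hsum, Finset.sum_range_add, add_sub_cancel_left]
    exact key L n
  obtain ⟨x, hx⟩ := hN.complete (fun n => j (b - R n)) (fun ε hε => by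
    obtain ⟨n₀, hn₀⟩ := eventually_atTop.1 (hpow.eventually (gt_mem_nhds hε))
    refine ⟨n₀, fun m hm n hn => ?_⟩
    rcases le_total n m with h | h
    · exact (hle n m h).trans_lt (hn₀ n hn)
    · rw [hN'.map_sub_comm]
      exact (hle m n h).trans_lt (hn₀ m hm))
  have hRlim : Tendsto R atTop (𝓝 0) := by
    refine squeeze_zero_norm hRn ?_
    simpa using (tendsto_pow_atTop_nhds_zero_of_lt_one hθ0.le hθ1).mul_const ‖b‖
  have hbx : j b = x := hj (fun n => b - R n) b x (by simpa using hRlim.const_sub b) hx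
  have hlim : Tendsto (fun n => κ * (N (j (b - R n) - x) + 2 * κ * (M * ‖b‖))) atTop
      (𝓝 (κ * (0 + 2 * κ * (M * ‖b‖)))) := (hx.add_const _).const_mul _
  have : N (j b) ≤ κ * (0 + 2 * κ * (M * ‖b‖)) := ge_of_tendsto' hlim fun n => by
    have h1 := hadd (x - j (b - R n)) (j (b - R n))
    rw [sub_add_cancel, ← hbx] at h1
    have h2 := key n 0
    simp only [zero_add, pow_zero, mul_one] at h2
    rw [hsum n] at h2
    rw [← hbx, hN'.map_sub_comm]
    exact h1.trans (by gcongr)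
  nlinarith

/-- Shapiro's Theorem holds for sets `A n` that are closed under scalar multiples and satisfy
`A n + A n ⊆ A (K n)`, if elements of a Banach space `B` mapped continuously into `V` stay, with
norm at most one, at a fixed positive distance from each `A n`. The category argument takes place
in `B`, so that the topology of `V` plays no role. -/
theorem satisfiesShapiro_of_bound (hN : IsQuasiNorm N) (j : B →ₗ[ℂ] V) {C : ℝ}
    (hC : ∀ b, N (j b) ≤ C * ‖b‖) {A : ℕ → Set V} (hzero : ∀ n, 0 ∈ A n)
    (hsmul : ∀ n, ∀ c : ℂ, ∀ x ∈ A n, c • x ∈ A n)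
    (hadd : ∃ K : ℕ → ℕ, ∀ n, ∀ x ∈ A n, ∀ y ∈ A n, x + y ∈ A (K n))
    (hfar : ∃ c > 0, ∀ n, ∃ b : B, ‖b‖ ≤ 1 ∧ ∀ a ∈ A n, c ≤ N (j b - a)) :
    SatisfiesShapiro N A := by
  intro ε hε hε0
  by_contra! hcon
  obtain ⟨K, hK⟩ := hadd
  obtain ⟨c, hc, hfar⟩ := hfar
  obtain ⟨κ, hκ, hκadd⟩ := hN.exists_one_le
  have hκ0 : 0 < κ := by linarith
  have hεn : ∀ n, 0 ≤ ε n := fun n => hε.le_of_tendsto hε0 n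
  obtain ⟨k, r, hr, hk⟩ := exists_ball_subset_closure_sub
    (Γ := fun k : ℕ => {b : B | ∀ n ≥ k, bestError N (j b) (A n) ≤ k * ε n}) (fun b => by
      obtain ⟨C', hC'⟩ := (hcon (j b)).bound
      obtain ⟨n₀, hn₀⟩ := eventually_atTop.1 hC'
      obtain ⟨k₁, hk₁⟩ := exists_nat_ge C'
      refine ⟨max n₀ k₁, fun n hn => ?_⟩
      have h := hn₀ n ((le_max_left _ _).trans hn)
      rw [Real.norm_of_nonneg (hεn n)] at h
      refine (le_abs_self _).trans (h.trans ?_)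
      refine mul_le_mul_of_nonneg_right (hk₁.trans ?_) (hεn n)
      exact_mod_cast le_max_right n₀ k₁)
  have hC1 : ∀ b, N (j b) ≤ max C 1 * ‖b‖ := fun b =>
    (hC b).trans (mul_le_mul_of_nonneg_right (le_max_left _ _) (norm_nonneg b))
  set C' := max C 1 with hC'
  have hC'0 : 0 < C' := lt_max_of_lt_right one_pos
  have near : ∀ n (b : B), bestError N (j b) (A n) ≤ k * ε n → ∀ δ > 0,
      ∃ a ∈ A n, N (j b - a) < k * ε n + δ := by
    intro n b h δ hδ
    have : Nonempty (A n) := ⟨⟨0, hzero n⟩⟩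
    have h' : ⨅ a : A n, N (j b - a) < k * ε n + δ := by
      unfold bestError at h
      linarith
    obtain ⟨⟨a, ha⟩, h⟩ := exists_lt_of_ciInf_lt h'
    exact ⟨a, ha, h⟩
  -- elements of a ball are approximated uniformly by elements of `A (K n)`
  have unif : ∀ b : B, ‖b‖ < r → ∀ n ≥ k, ∀ δ > 0, ∃ a ∈ A (K n),
      N (j b - a) ≤ κ * (C' * δ + κ * (2 * (k * ε n + δ))) := by
    intro b hb n hn δ hδ
    obtain ⟨y₁, hy₁, y₂, hy₂, hy⟩ := hk b hb δ hδ
    obtain ⟨a₁, ha₁, h1⟩ := near n y₁ (hy₁ n hn) δ hδ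
    obtain ⟨a₂, ha₂, h2⟩ := near n y₂ (hy₂ n hn) δ hδ
    refine ⟨a₁ + (-1 : ℂ) • a₂, hK n _ ha₁ _ (hsmul n _ _ ha₂), ?_⟩
    have e : j b - (a₁ + (-1 : ℂ) • a₂)
        = j (b - (y₁ - y₂)) + ((j y₁ - a₁) + (-(j y₂ - a₂))) := by
      simp only [map_sub, neg_smul, one_smul]; abel
    have h3 := hκadd (j y₁ - a₁) (-(j y₂ - a₂))
    rw [hN.map_neg] at h3
    have h4 : N (j (b - (y₁ - y₂))) ≤ C' * δ := (hC1 _).trans (by gcongr)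
    rw [e]
    refine (hκadd _ _).trans ?_
    gcongr
    refine h3.trans ?_
    gcongr
    linarith
  have hlim : Tendsto (fun n => κ * (C' * ε n + κ * (2 * (k * ε n + ε n)))) atTop (𝓝 0) := by
    have h1 : Tendsto (fun n => κ * (C' * ε n + κ * (2 * (k * ε n + ε n)))) atTop
        (𝓝 (κ * (C' * 0 + κ * (2 * (k * 0 + 0))))) :=
      ((hε0.const_mul _).add ((((hε0.const_mul _).add hε0).const_mul _).const_mul _)).const_mul _
    simpa using h1
  have hdelta : ∃ n ≥ k, ∃ δ > 0, κ * (C' * δ + κ * (2 * (k * ε n + δ))) < r / 2 * c := by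
    have hpos : 0 < r / 2 * c / 2 := by positivity
    obtain ⟨n, hn, hnk⟩ := ((hlim.eventually (gt_mem_nhds hpos)).and
      (eventually_ge_atTop k)).exists
    refine ⟨n, hnk, r / 2 * c / 2 / (κ * (C' + κ * 2)), by positivity, ?_⟩
    have h1 : κ * (κ * (2 * (k * ε n))) < r / 2 * c / 2 := by
      refine lt_of_le_of_lt ?_ hn
      have := hεn n
      gcongr
      have : 0 ≤ C' * ε n := by positivity
      nlinarith [mul_nonneg hκ0.le this, mul_nonneg hκ0.le (hεn n)]
    have h2 : κ * (C' * (r / 2 * c / 2 / (κ * (C' + κ * 2)))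
        + κ * (2 * (r / 2 * c / 2 / (κ * (C' + κ * 2))))) = r / 2 * c / 2 := by
      field_simp
    calc _ = κ * (κ * (2 * (k * ε n))) + κ * (C' * (r / 2 * c / 2 / (κ * (C' + κ * 2)))
        + κ * (2 * (r / 2 * c / 2 / (κ * (C' + κ * 2))))) := by ring
      _ < _ := by linarith
  obtain ⟨n, hn, δ, hδ, hlt⟩ := hdelta
  obtain ⟨b, hb, hfarb⟩ := hfar (K n)
  have hrn : ‖((r / 2 : ℝ) : ℂ)‖ = r / 2 := by
    rw [Complex.norm_real, Real.norm_of_nonneg (by positivity)]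
  have hrc : ((r / 2 : ℝ) : ℂ) ≠ 0 := by exact_mod_cast (half_pos hr).ne'
  obtain ⟨a, ha, hle⟩ := unif (((r / 2 : ℝ) : ℂ) • b) (by
    rw [norm_smul, hrn]; nlinarith) n hn δ hδ
  have h1 := hfarb _ (hsmul _ ((r / 2 : ℝ) : ℂ)⁻¹ a ha)
  have h2 : j (((r / 2 : ℝ) : ℂ) • b) - a
      = ((r / 2 : ℝ) : ℂ) • (j b - ((r / 2 : ℝ) : ℂ)⁻¹ • a) := by
    rw [smul_sub, smul_inv_smul₀ hrc, map_smul]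
  rw [h2, hN.smul, hrn] at hle
  have h3 : r / 2 * c ≤ r / 2 * N (j b - ((r / 2 : ℝ) : ℂ)⁻¹ • a) := by gcongr
  linarith

/-- Replacing the image of a vector of `B` by the image of a close vector is harmless, if `B` is
mapped continuously into `V`. -/
theorem exists_quasiNorm_sub_lt (hN : IsQuasiNorm N) {B : Type*} [NormedAddCommGroup B]
    [NormedSpace ℂ B] {j : B →ₗ[ℂ] V} {C : ℝ} (hC0 : 0 < C) (hC : ∀ b, N (j b) ≤ C * ‖b‖) {ε : ℝ}
    (hε : 0 < ε) : ∃ η > 0, ∀ x f, N (x - j f) < η → ∀ g, ‖f - g‖ ≤ η → N (x - j g) < ε := by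
  obtain ⟨κ, hκ, hadd⟩ := hN.exists_one_le
  have hκ0 : 0 < κ := by linarith
  refine ⟨ε / (κ * (1 + C)), by positivity, fun x f hx g hg => ?_⟩
  refine (sub_le_of_add_le_mul hadd x (j f) (j g)).trans_lt ?_
  calc κ * (N (x - j f) + N (j f - j g))
      ≤ κ * (N (x - j f) + C * (ε / (κ * (1 + C)))) := by
        gcongr
        exact (quasiNorm_map_sub_le hC f g).trans (by gcongr)
    _ < κ * (ε / (κ * (1 + C)) + C * (ε / (κ * (1 + C)))) := by gcongr
    _ = ε := by field_simp

end QuasiNorm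

/-! ### Algebra of rational functions -/

section RationalFunctions

variable {T : Type*}

theorem sum_Icc_neg_eq_sum_range (n : ℕ) (g : ℤ → ℂ) :
    ∑ k ∈ Finset.Icc (-(n : ℤ)) n, g k = ∑ i ∈ Finset.range (2 * n + 1), g ((i : ℤ) - n) := by
  symm
  refine Finset.sum_bij (fun i _ => (i : ℤ) - n) ?_ ?_ ?_ fun _ _ => rfl
  · intro i hi
    simp only [Finset.mem_range, Finset.mem_Icc] at hi ⊢
    omega
  · intro i _ j _ h
    exact_mod_cast (sub_left_injective h : (i : ℤ) = j)
  · intro k hk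
    simp only [Finset.mem_Icc] at hk
    refine ⟨(k + n).toNat, ?_, ?_⟩
    · simp only [Finset.mem_range]; omega
    · omega

/-- A trigonometric polynomial of degree `n` is `w⁻ⁿ` times an algebraic polynomial of degree
`2n` in `w`. -/
theorem exists_polynomial_of_laurent (n : ℕ) (a : ℤ → ℂ) :
    ∃ P : ℂ[X], P.natDegree ≤ 2 * n ∧ ∀ w : ℂ, w ≠ 0 →
      ∑ k ∈ Finset.Icc (-(n : ℤ)) n, a k * w ^ k = P.eval w / w ^ n := by
  refine ⟨∑ i ∈ Finset.range (2 * n + 1), C (a ((i : ℤ) - n)) * X ^ i, ?_, fun w hw => ?_⟩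
  · refine natDegree_sum_le_of_forall_le _ _ fun i hi => ?_
    refine (natDegree_C_mul_X_pow_le _ _).trans ?_
    rw [Finset.mem_range] at hi
    omega
  · rw [sum_Icc_neg_eq_sum_range, eval_finsetSum, Finset.sum_div]
    refine Finset.sum_congr rfl fun i _ => ?_
    simp only [eval_mul, eval_C, eval_pow, eval_X]
    rw [zpow_sub₀ hw, zpow_natCast, zpow_natCast, mul_div_assoc]

theorem exists_laurent_of_polynomial (n : ℕ) {P : ℂ[X]} (hP : P.natDegree ≤ 2 * n) :
    ∃ a : ℤ → ℂ, ∀ w : ℂ, w ≠ 0 →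
      ∑ k ∈ Finset.Icc (-(n : ℤ)) n, a k * w ^ k = P.eval w / w ^ n := by
  refine ⟨fun k => P.coeff (k + n).toNat, fun w hw => ?_⟩
  rw [sum_Icc_neg_eq_sum_range, eval_eq_sum_range' (Nat.lt_succ_of_le hP), Finset.sum_div]
  refine Finset.sum_congr rfl fun i _ => ?_
  rw [zpow_sub₀ hw, zpow_natCast, zpow_natCast, mul_div_assoc]
  simp

/-- Multiplying numerator and denominator by `eⁿ` turns trigonometric rational functions of degree
`n` into algebraic rational functions of degree `2n` in `e`. -/
theorem trigRatFunctions_eq {e : T → ℂ} (he : ∀ t, e t ≠ 0) (n : ℕ) :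
    trigRatFunctions e n = ratFunctions e (2 * n) := by
  ext f
  constructor
  · rintro ⟨a, b, hb, hf⟩
    obtain ⟨P, hP, hPa⟩ := exists_polynomial_of_laurent n a
    obtain ⟨Q, hQ, hQb⟩ := exists_polynomial_of_laurent n b
    refine ⟨P, Q, hP, hQ, fun t h => hb t ?_, fun t => ?_⟩
    · rw [hQb _ (he t), h, zero_div]
    · rw [hf, hPa _ (he t), hQb _ (he t), div_div_div_cancel_right₀ (pow_ne_zero _ (he t))]
  · rintro ⟨P, Q, hP, hQ, hQ0, hf⟩
    obtain ⟨a, ha⟩ := exists_laurent_of_polynomial n hP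
    obtain ⟨b, hb⟩ := exists_laurent_of_polynomial n hQ
    refine ⟨a, b, fun t => ?_, fun t => ?_⟩
    · rw [hb _ (he t)]
      exact div_ne_zero (hQ0 t) (pow_ne_zero _ (he t))
    · rw [hf, ha _ (he t), hb _ (he t), div_div_div_cancel_right₀ (pow_ne_zero _ (he t))]

theorem zero_mem_ratFunctions (z : T → ℂ) (n : ℕ) : (0 : T → ℂ) ∈ ratFunctions z n :=
  ⟨0, 1, by simp, by simp, by simp, by simp⟩

theorem ratFunctions_mono (z : T → ℂ) {m n : ℕ} (h : m ≤ n) :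
    ratFunctions z m ⊆ ratFunctions z n := by
  rintro f ⟨p, q, hp, hq, hq0, hf⟩
  exact ⟨p, q, hp.trans h, hq.trans h, hq0, hf⟩

theorem smul_mem_ratFunctions {z : T → ℂ} {n : ℕ} {f : T → ℂ} (hf : f ∈ ratFunctions z n) (c : ℂ) :
    c • f ∈ ratFunctions z n := by
  obtain ⟨p, q, hp, hq, hq0, hf⟩ := hf
  refine ⟨C c * p, q, (natDegree_C_mul_le _ _).trans hp, hq, hq0, fun t => ?_⟩
  rw [Pi.smul_apply, hf, smul_eq_mul, eval_mul, eval_C, mul_div_assoc]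

theorem add_mem_ratFunctions {z : T → ℂ} {n : ℕ} {f g : T → ℂ} (hf : f ∈ ratFunctions z n)
    (hg : g ∈ ratFunctions z n) : f + g ∈ ratFunctions z (2 * n) := by
  obtain ⟨p, q, hp, hq, hq0, hf⟩ := hf
  obtain ⟨p', q', hp', hq', hq0', hg⟩ := hg
  refine ⟨p * q' + q * p', q * q', ?_, ?_, fun t => ?_, fun t => ?_⟩
  · refine (natDegree_add_le _ _).trans (max_le ?_ ?_)
    · exact natDegree_mul_le.trans (by omega)
    · exact natDegree_mul_le.trans (by omega)
  · exact natDegree_mul_le.trans (by omega)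
  · rw [eval_mul]; exact mul_ne_zero (hq0 t) (hq0' t)
  · rw [Pi.add_apply, hf, hg, eval_add, eval_mul, eval_mul, eval_mul,
      div_add_div _ _ (hq0 t) (hq0' t)]

theorem continuous_of_mem_ratFunctions [TopologicalSpace T] {z : T → ℂ} (hz : Continuous z) {n : ℕ}
    {f : T → ℂ} (hf : f ∈ ratFunctions z n) : Continuous f := by
  obtain ⟨p, q, -, -, hq0, hf⟩ := hf
  rw [show f = fun t => p.eval (z t) / q.eval (z t) from funext hf]
  exact (p.continuous.comp hz).div (q.continuous.comp hz) hq0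

/-- A rational function in lowest terms with a pole of order `m` does not agree, at infinitely many
points, with a rational function of degree less than `m`. -/
theorem ne_of_mem_ratFunctions {z : T → ℂ} {S : Set T} (hS : (z '' S).Infinite) {w : ℂ} {r : ℂ[X]}
    (hr : r.eval w ≠ 0) (hw : ∀ t, z t ≠ w) {m n : ℕ} (hnm : n < m) {f : T → ℂ}
    (hf : f ∈ ratFunctions z n) :
    ∃ t ∈ S, f t ≠ r.eval (z t) / (z t - w) ^ m := by
  by_contra! h
  obtain ⟨p, q, -, hq, hq0, hf⟩ := hf
  have hzero : p * (X - C w) ^ m - r * q = 0 := by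
    refine eq_zero_of_infinite_isRoot _ (hS.mono ?_)
    rintro _ ⟨t, ht, rfl⟩
    have h1 := h t ht
    rw [hf, div_eq_div_iff (hq0 t) (pow_ne_zero _ (sub_ne_zero.2 (hw t)))] at h1
    simp [IsRoot, h1]
  have hdvd : (X - C w) ^ m ∣ r * q := ⟨p, by rw [mul_comm _ p]; exact (sub_eq_zero.1 hzero).symm⟩
  have hcop : IsCoprime ((X - C w) ^ m) r := by
    refine IsCoprime.pow_left ((irreducible_X_sub_C w).coprime_iff_not_dvd.2 fun h => hr ?_)
    exact dvd_iff_isRoot.1 h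
  have hdvd' := hcop.dvd_of_dvd_mul_left hdvd
  have hq_zero : q = 0 := by
    refine eq_zero_of_dvd_of_natDegree_lt hdvd' ?_
    rw [natDegree_pow, natDegree_X_sub_C]
    omega
  obtain ⟨_, t, -, rfl⟩ := hS.nonempty
  exact hq0 t (by simp [hq_zero])

/-- The conjugate of a polynomial on the real line, or on the unit circle, is again a polynomial up
to a factor without zeros. -/
theorem exists_conj_polynomial {z : T → ℂ} (hz : (∀ t, (z t).im = 0) ∨ ∀ t, ‖z t‖ = 1) (n : ℕ) :
    ∃ ω : T → ℂ, (∀ t, ω t ≠ 0) ∧ ∀ p : ℂ[X], p.natDegree ≤ n → ∃ p' : ℂ[X], p'.natDegree ≤ n ∧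
      ∀ t, p'.eval (z t) = ω t * (starRingEnd ℂ) (p.eval (z t)) := by
  rcases hz with hz | hz
  · refine ⟨1, by simp, fun p hp => ⟨p.map (starRingEnd ℂ), natDegree_map_le.trans hp, fun t => ?_⟩⟩
    have h := Complex.conj_eq_iff_im.2 (hz t)
    rw [Pi.one_apply, one_mul, ← h, eval_map, eval₂_hom, h]
  · have hz0 : ∀ t, z t ≠ 0 := fun t h => by simpa [h] using hz t
    refine ⟨fun t => z t ^ n, fun t => pow_ne_zero _ (hz0 t), fun p hp =>
      ⟨reflect n (p.map (starRingEnd ℂ)), natDegree_reflect_le.trans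
        (max_le le_rfl (natDegree_map_le.trans hp)), fun t => ?_⟩⟩
    have hconj : (z t)⁻¹ = (starRingEnd ℂ) (z t) := by
      rw [Complex.inv_def, Complex.normSq_eq_norm_sq, hz t]; simp
    let _ := invertibleOfNonzero (inv_ne_zero (hz0 t))
    have h := eval₂_reflect_mul_pow (RingHom.id ℂ) (z t)⁻¹ n (p.map (starRingEnd ℂ))
      (natDegree_map_le.trans hp)
    rw [invOf_eq_inv, inv_inv, ← eval, ← eval] at h
    nth_rewrite 2 [hconj] at h
    rw [eval_map, eval₂_hom, inv_pow] at h
    simp only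
    rw [← h]
    field_simp [hz0 t]

/-- The real part of a rational function of degree `n` vanishes, on the real line or on the unit
circle, either identically or at no more than `2n` points. -/
theorem re_ratFunction_zeros {z : T → ℂ} (hz : (∀ t, (z t).im = 0) ∨ ∀ t, ‖z t‖ = 1) {n : ℕ}
    {f : T → ℂ} (hf : f ∈ ratFunctions z n) :
    (∀ t, (f t).re = 0) ∨ ∃ Z : Finset ℂ, Z.card ≤ 2 * n ∧ ∀ t, (f t).re = 0 → z t ∈ Z := by
  obtain ⟨p, q, hp, hq, hq0, hf⟩ := hf
  obtain ⟨ω, hω, hconj⟩ := exists_conj_polynomial hz n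
  obtain ⟨p', hp', hpe⟩ := hconj p hp
  obtain ⟨q', hq', hqe⟩ := hconj q hq
  -- `2 ω |q|² Re (p / q) = ω (p q̄ + p̄ q)` is a polynomial of degree at most `2n`
  have hF : ∀ t, (p * q' + p' * q).eval (z t) = 0 ↔ (f t).re = 0 := by
    intro t
    have h1 : (p * q' + p' * q).eval (z t)
        = ω t * ((2 * (f t).re * Complex.normSq (q.eval (z t)) : ℝ) : ℂ) := by
      rw [eval_add, eval_mul, eval_mul, hpe, hqe]
      push_cast
      have h0 := (Complex.add_conj (f t)).symm
      push_cast at h0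
      rw [h0, ← Complex.mul_conj, hf, map_div₀]
      have h2 := hq0 t
      have h3 : (starRingEnd ℂ) (q.eval (z t)) ≠ 0 := by simpa using h2
      field_simp
    rw [h1]
    have h2 : Complex.normSq (q.eval (z t)) ≠ 0 := by simpa using hq0 t
    simp [hω t, hq0 t]
  by_cases h : p * q' + p' * q = 0
  · left
    intro t
    rw [← hF, h, eval_zero]
  · right
    refine ⟨(p * q' + p' * q).roots.toFinset, ?_, fun t ht => ?_⟩
    · refine (Multiset.toFinset_card_le _).trans ((card_roots' _).trans ?_)
      refine (natDegree_add_le _ _).trans (max_le ?_ ?_)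
      · exact natDegree_mul_le.trans (by omega)
      · exact natDegree_mul_le.trans (by omega)
    · rw [Multiset.mem_toFinset, mem_roots h]
      exact (hF t).2 ht

end RationalFunctions

/-! ### Oscillating functions are far from functions with few zeros -/

theorem one_half_le_sin {x : ℝ} (h₁ : 1 / 12 ≤ x) (h₂ : x ≤ 5 / 12) :
    1 / 2 ≤ Real.sin (2 * Real.pi * x) := by
  have hpi := Real.pi_pos
  have key : ∀ y : ℝ, 1 / 12 ≤ y → y ≤ 1 / 4 → 1 / 2 ≤ Real.sin (2 * Real.pi * y) := by
    intro y h₁ h₂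
    rw [← Real.sin_pi_div_six]
    apply Real.sin_le_sin_of_le_of_le_pi_div_two <;> nlinarith
  rcases le_total x (1 / 4) with h | h
  · exact key x h₁ h
  · have := key (1 / 2 - x) (by linarith) (by linarith)
    rwa [show 2 * Real.pi * (1 / 2 - x) = Real.pi - 2 * Real.pi * x by ring,
      Real.sin_pi_sub] at this

/-- A function whose zeros have at most `D` different values under an injective map is at distance
at least `1/2` from a sine wave with `M` periods on a set of measure at least `(M - D) / (3 M)` of
the length of the interval: on each of the `M - D` periods without zeros it has a constant sign. -/
theorem volume_far_from_sine {u v : ℝ} (huv : u < v) {M D : ℕ} (hM : 0 < M) {ρ : ℝ → ℝ}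
    (hρ : ContinuousOn ρ (Set.Ioo u v)) {z : ℝ → ℂ} (hz : Set.InjOn z (Set.Ioo u v))
    (hzero : (∀ t ∈ Set.Ioo u v, ρ t = 0) ∨
      ∃ Z : Finset ℂ, Z.card ≤ D ∧ ∀ t ∈ Set.Ioo u v, ρ t = 0 → z t ∈ Z) :
    ENNReal.ofReal (((M : ℝ) - D) * ((v - u) / M / 3)) ≤
      volume {t ∈ Set.Ioo u v |
        1 / 2 ≤ |Real.sin (2 * Real.pi * (M * (t - u) / (v - u))) - ρ t|} := by
  classical
  set δ := (v - u) / M with hδ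
  have hvu : 0 < v - u := sub_pos.2 huv
  have hM0 : (0 : ℝ) < M := by exact_mod_cast hM
  have hδ0 : 0 < δ := by positivity
  have hMδ : M * δ = v - u := by rw [hδ]; field_simp
  let J : ℕ → Set ℝ := fun k => Set.Ioo (u + k * δ) (u + (k + 1) * δ)
  have hJsub : ∀ k < M, J k ⊆ Set.Ioo u v := by
    intro k hk
    have h1 : ((k : ℝ) + 1) ≤ M := by exact_mod_cast hk
    refine Set.Ioo_subset_Ioo ?_ ?_
    · have : 0 ≤ (k : ℝ) * δ := by positivity
      linarith
    · have : ((k : ℝ) + 1) * δ ≤ M * δ := by gcongr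
      linarith
  have hJdisj : ∀ k l : ℕ, k < l → Disjoint (J k) (J l) := by
    intro k l hkl
    rw [Set.disjoint_left]
    intro t h1 h2
    have h3 : ((k : ℝ) + 1) ≤ l := by exact_mod_cast hkl
    have : ((k : ℝ) + 1) * δ ≤ l * δ := by gcongr
    linarith [h1.2, h2.1]
  set sgn : ℕ → Prop := fun k => (∀ t ∈ J k, 0 ≤ ρ t) ∨ (∀ t ∈ J k, ρ t ≤ 0) with hsgn
  set good := (Finset.range M).filter sgn with hgood
  have hcard : (M : ℝ) - D ≤ good.card := by
    have hbad : ((Finset.range M).filter fun k => ¬ sgn k).card ≤ D := by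
      rcases hzero with hzero | ⟨Z, hZ, hzero⟩
      · rw [Finset.filter_false_of_mem, Finset.card_empty]
        · exact Nat.zero_le _
        · intro k hk
          rw [not_not]
          exact Or.inl fun t ht => (hzero t (hJsub k (Finset.mem_range.1 hk) ht)).ge
      · have hex : ∀ k ∈ (Finset.range M).filter (fun k => ¬ sgn k), ∃ t ∈ J k, ρ t = 0 := by
          intro k hk
          obtain ⟨hkM, hk⟩ := Finset.mem_filter.1 hk
          simp only [hsgn, not_or, not_forall, not_le, exists_prop] at hk
          obtain ⟨⟨t₁, ht₁, h1⟩, ⟨t₂, ht₂, h2⟩⟩ := hk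
          have hpre : IsPreconnected (J k) := isPreconnected_Ioo
          obtain ⟨t, ht, h⟩ := hpre.intermediate_value ht₁ ht₂
            (hρ.mono (hJsub k (Finset.mem_range.1 hkM))) ⟨h1.le, h2.le⟩
          exact ⟨t, ht, h⟩
        choose! τ hτJ hτ using hex
        refine (Finset.card_le_card_of_injOn (fun k => z (τ k)) (fun k hk => ?_) ?_).trans hZ
        · have hkM := Finset.mem_range.1 (Finset.mem_filter.1 hk).1
          exact hzero _ (hJsub k hkM (hτJ k hk)) (hτ k hk)
        · intro k hk l hl hkl
          have hkM := Finset.mem_range.1 (Finset.mem_filter.1 hk).1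
          have hlM := Finset.mem_range.1 (Finset.mem_filter.1 hl).1
          have heq := hz (hJsub k hkM (hτJ k hk)) (hJsub l hlM (hτJ l hl)) hkl
          by_contra hne
          rcases lt_or_gt_of_ne hne with h | h
          · exact Set.disjoint_left.1 (hJdisj k l h) (hτJ k hk) (heq ▸ hτJ l hl)
          · exact Set.disjoint_left.1 (hJdisj l k h) (hτJ l hl) (heq ▸ hτJ k hk)
    have : good.card + ((Finset.range M).filter fun k => ¬ sgn k).card = M := by
      rw [hgood, Finset.card_filter_add_card_filter_not, Finset.card_range]
    have h2 : M ≤ good.card + D := by omega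
    have h3 : (M : ℝ) ≤ good.card + D := by exact_mod_cast h2
    linarith
  -- on a period where `ρ` has constant sign, the sine wave has the opposite sign on one half
  have hsin : ∀ (k : ℕ) (t : ℝ), Real.sin (2 * Real.pi * (M * (t - u) / (v - u)))
      = Real.sin (2 * Real.pi * ((t - (u + k * δ)) / δ)) := by
    intro k t
    rw [← Real.sin_add_nat_mul_two_pi (2 * Real.pi * ((t - (u + k * δ)) / δ)) k]
    congr 1
    rw [hδ]
    field_simp
    ring
  have hS : ∀ k ∈ good, ∃ s : ℝ, Set.Icc s (s + δ / 3) ⊆ J k ∧ ∀ t ∈ Set.Icc s (s + δ / 3),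
      1 / 2 ≤ |Real.sin (2 * Real.pi * (M * (t - u) / (v - u))) - ρ t| := by
    intro k hk
    obtain ⟨-, hk | hk⟩ := Finset.mem_filter.1 hk
    · refine ⟨u + k * δ + 7 / 12 * δ, ?_, ?_⟩
      · exact fun t ht => ⟨by linarith [ht.1], by linarith [ht.2]⟩
      · intro t ht
        have h1 := hk t ⟨by linarith [ht.1], by linarith [ht.2]⟩
        have h2 := one_half_le_sin (x := (t - (u + k * δ)) / δ - 1 / 2)
          (by rw [le_sub_iff_add_le, le_div_iff₀ hδ0]; linarith [ht.1])
          (by rw [sub_le_iff_le_add, div_le_iff₀ hδ0]; linarith [ht.2])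
        rw [show 2 * Real.pi * ((t - (u + k * δ)) / δ - 1 / 2)
          = 2 * Real.pi * ((t - (u + k * δ)) / δ) - Real.pi by ring, Real.sin_sub_pi] at h2
        rw [hsin k t, abs_sub_comm]
        exact le_trans (by linarith) (le_abs_self _)
    · refine ⟨u + k * δ + 1 / 12 * δ, ?_, ?_⟩
      · exact fun t ht => ⟨by linarith [ht.1], by linarith [ht.2]⟩
      · intro t ht
        have h1 := hk t ⟨by linarith [ht.1], by linarith [ht.2]⟩
        have h2 := one_half_le_sin (x := (t - (u + k * δ)) / δ)
          (by rw [le_div_iff₀ hδ0]; linarith [ht.1])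
          (by rw [div_le_iff₀ hδ0]; linarith [ht.2])
        rw [hsin k t]
        exact le_trans (by linarith) (le_abs_self _)
  choose! s hsJ hs using hS
  calc ENNReal.ofReal (((M : ℝ) - D) * (δ / 3))
      ≤ ENNReal.ofReal (good.card * (δ / 3)) := by gcongr
    _ = ∑ k ∈ good, volume (Set.Icc (s k) (s k + δ / 3)) := by
        simp only [Real.volume_Icc, add_sub_cancel_left, Finset.sum_const, nsmul_eq_mul]
        rw [ENNReal.ofReal_mul (by positivity), ENNReal.ofReal_natCast]
    _ = volume (⋃ k ∈ good, Set.Icc (s k) (s k + δ / 3)) := by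
        refine (measure_biUnion_finset (fun k hk l hl hkl => ?_) fun k _ => measurableSet_Icc).symm
        rcases lt_or_gt_of_ne hkl with h | h
        · exact (hJdisj k l h).mono (hsJ k hk) (hsJ l hl)
        · exact ((hJdisj l k h).mono (hsJ l hl) (hsJ k hk)).symm
    _ ≤ _ := by
        refine measure_mono (Set.iUnion₂_subset fun k hk t ht => ⟨?_, hs k hk t ht⟩)
        exact hJsub k (Finset.mem_range.1 (Finset.mem_filter.1 hk).1) (hsJ k hk ht)

/-! ### Spaces between `C₀` and `L_p` -/

section BetweenC0AndLp

open scoped ZeroAtInfty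

variable {Ω : Type*} [MeasurableSpace Ω]
  {μ : Measure Ω} {p : ℝ} {X : Submodule ℂ (Ω →ₘ[μ] ℂ)} {N : X → ℝ}

theorem subtype_ext_of_ae_eq {x y : X} (h : (x : Ω →ₘ[μ] ℂ) =ᵐ[μ] (y : Ω →ₘ[μ] ℂ)) : x = y :=
  Subtype.ext (AEEqFun.ext h)

theorem coe_add_ae {x y : X} {f g : Ω → ℂ} (hf : (x : Ω →ₘ[μ] ℂ) =ᵐ[μ] f)
    (hg : (y : Ω →ₘ[μ] ℂ) =ᵐ[μ] g) : ((x + y : X) : Ω →ₘ[μ] ℂ) =ᵐ[μ] f + g :=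
  (AEEqFun.coeFn_add _ _).trans (hf.add hg)

theorem coe_sub_ae {x y : X} {f g : Ω → ℂ} (hf : (x : Ω →ₘ[μ] ℂ) =ᵐ[μ] f)
    (hg : (y : Ω →ₘ[μ] ℂ) =ᵐ[μ] g) : ((x - y : X) : Ω →ₘ[μ] ℂ) =ᵐ[μ] f - g :=
  (AEEqFun.coeFn_sub _ _).trans (hf.sub hg)

theorem coe_smul_ae (c : ℂ) {x : X} {f : Ω → ℂ} (hf : (x : Ω →ₘ[μ] ℂ) =ᵐ[μ] f) :
    ((c • x : X) : Ω →ₘ[μ] ℂ) =ᵐ[μ] c • f :=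
  (AEEqFun.coeFn_smul c _).trans (hf.const_smul c)

theorem zero_mem_elementsIn {F : Set (Ω → ℂ)} (h : 0 ∈ F) : (0 : X) ∈ elementsIn X F :=
  ⟨0, h, AEEqFun.coeFn_zero⟩

theorem smul_mem_elementsIn_ratFunctions {z : Ω → ℂ} {n : ℕ} (c : ℂ) {x : X}
    (hx : x ∈ elementsIn X (ratFunctions z n)) : c • x ∈ elementsIn X (ratFunctions z n) := by
  obtain ⟨f, hf, hx⟩ := hx
  exact ⟨c • f, smul_mem_ratFunctions hf c, coe_smul_ae c hx⟩

theorem elementsIn_ratFunctions_mono {z : Ω → ℂ} {m n : ℕ} (h : m ≤ n) :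
    elementsIn X (ratFunctions z m) ⊆ elementsIn X (ratFunctions z n) :=
  fun _ ⟨f, hf, hx⟩ => ⟨f, ratFunctions_mono z h hf, hx⟩

theorem add_mem_elementsIn_ratFunctions {z : Ω → ℂ} {m n : ℕ} (h : 2 * n ≤ m) {x y : X}
    (hx : x ∈ elementsIn X (ratFunctions z n)) (hy : y ∈ elementsIn X (ratFunctions z n)) :
    x + y ∈ elementsIn X (ratFunctions z m) := by
  obtain ⟨f, hf, hx⟩ := hx
  obtain ⟨g, hg, hy⟩ := hy
  exact ⟨f + g, ratFunctions_mono z h (add_mem_ratFunctions hf hg), coe_add_ae hx hy⟩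

/-- If the coordinate `z` takes each value on a null set only, a set of full measure has infinitely
many coordinates. -/
theorem infinite_image_of_ae (hμ : μ ≠ 0) {z : Ω → ℂ} (hz : ∀ ζ, μ (z ⁻¹' {ζ}) = 0) {S : Set Ω}
    (hS : ∀ᵐ t ∂μ, t ∈ S) : (z '' S).Infinite := by
  intro hfin
  refine hμ (Measure.measure_univ_eq_zero.1 ?_)
  have h1 : μ (z ⁻¹' (z '' S)) = 0 := by
    rw [← Set.biUnion_preimage_singleton]
    exact (measure_biUnion_null_iff hfin.countable).2 fun ζ _ => hz ζ
  have h2 : μ S = 0 := measure_mono_null (Set.subset_preimage_image z S) h1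
  rw [← Set.union_compl_self S]
  exact measure_union_null h2 hS

/-- Chebyshev's inequality for functions of absolute value at least `a` on a large set. -/
theorem ofReal_le_eLpNorm_of_le_measure (hp : 0 < p) {h : Ω → ℂ} (hh : AEStronglyMeasurable h μ)
    {a m : ℝ} (ha : 0 ≤ a) (hm : 0 ≤ m) (hmeas : ENNReal.ofReal m ≤ μ {t | a ≤ ‖h t‖}) :
    ENNReal.ofReal (a * m ^ (1 / p)) ≤ eLpNorm h (ENNReal.ofReal p) μ := by
  have hp0 : ENNReal.ofReal p ≠ 0 := by simpa using hp
  have h1 := mul_meas_ge_le_pow_eLpNorm' μ hp0 ENNReal.ofReal_ne_top hh (ENNReal.ofReal a)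
  rw [ENNReal.toReal_ofReal hp.le] at h1
  have hset : {t | ENNReal.ofReal a ≤ ‖h t‖ₑ} = {t | a ≤ ‖h t‖} := by
    ext t
    rw [Set.mem_ofPred_eq, Set.mem_ofPred_eq, ← ofReal_norm,
      ENNReal.ofReal_le_ofReal_iff (norm_nonneg _)]
  rw [hset] at h1
  rw [← ENNReal.rpow_le_rpow_iff hp]
  refine le_trans ?_ h1
  rw [ENNReal.ofReal_mul ha, ENNReal.mul_rpow_of_nonneg _ _ hp.le,
    ENNReal.ofReal_rpow_of_nonneg (Real.rpow_nonneg hm _) hp.le, ← Real.rpow_mul hm,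
    one_div_mul_cancel hp.ne', Real.rpow_one]
  gcongr

variable [TopologicalSpace Ω]

/-- The inclusion `C₀(Ω) → X`, which sends a function to its class. -/
def IsBetweenC0AndLp.inclusion (hX : IsBetweenC0AndLp μ p X N) : C₀(Ω, ℂ) →ₗ[ℂ] X where
  toFun f := (hX.C0_subset f).choose
  map_add' f g := subtype_ext_of_ae_eq <| (hX.C0_subset (f + g)).choose_spec.trans
    (coe_add_ae (hX.C0_subset f).choose_spec (hX.C0_subset g).choose_spec).symm
  map_smul' c f := subtype_ext_of_ae_eq <| (hX.C0_subset (c • f)).choose_spec.trans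
    (coe_smul_ae c (hX.C0_subset f).choose_spec).symm

theorem IsBetweenC0AndLp.coe_inclusion (hX : IsBetweenC0AndLp μ p X N) (f : C₀(Ω, ℂ)) :
    (hX.inclusion f : Ω →ₘ[μ] ℂ) =ᵐ[μ] f := (hX.C0_subset f).choose_spec

theorem IsBetweenC0AndLp.eq_inclusion (hX : IsBetweenC0AndLp μ p X N) {f : C₀(Ω, ℂ)} {y : X}
    (h : (y : Ω →ₘ[μ] ℂ) =ᵐ[μ] f) : hX.inclusion f = y :=
  subtype_ext_of_ae_eq ((hX.coe_inclusion f).trans h.symm)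

theorem IsBetweenC0AndLp.exists_one_le (hX : IsBetweenC0AndLp μ p X N) :
    ∃ C : ℝ, 1 ≤ C ∧ ∀ x : X,
      eLpNorm (x : Ω →ₘ[μ] ℂ) (ENNReal.ofReal p) μ ≤ ENNReal.ofReal (C * N x) := by
  obtain ⟨C, hC⟩ := hX.subset_Lp
  refine ⟨max C 1, le_max_right _ _, fun x => (hC x).trans (ENNReal.ofReal_le_ofReal ?_)⟩
  exact mul_le_mul_of_nonneg_right (le_max_left _ _) (hX.quasiBanach.nonneg x)

theorem IsBetweenC0AndLp.exists_bound (hX : IsBetweenC0AndLp μ p X N) (hp : 0 < p) :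
    ∃ C > 0, ∀ f, N (hX.inclusion f) ≤ C * ‖f‖ := by
  refine exists_bound_of_closed_graph hX.quasiBanach hX.inclusion fun u b x hu hx => ?_
  obtain ⟨C, -, hC⟩ := hX.exists_one_le
  -- convergence in `L_p` gives almost everywhere convergence of a subsequence
  have h0 : Tendsto (fun n => eLpNorm
      (((hX.inclusion (u n) : Ω →ₘ[μ] ℂ) : Ω → ℂ) - ((x : Ω →ₘ[μ] ℂ) : Ω → ℂ))
      (ENNReal.ofReal p) μ) atTop (𝓝 0) := by
    refine tendsto_of_tendsto_of_tendsto_of_le_of_le (h := fun n =>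
      ENNReal.ofReal (C * N (hX.inclusion (u n) - x))) tendsto_const_nhds ?_ (fun n => zero_le)
      fun n => ?_
    · have := ENNReal.tendsto_ofReal (hx.const_mul C)
      simpa using this
    · refine le_trans (eLpNorm_congr_ae ?_).le (hC _)
      exact (AEEqFun.coeFn_sub _ _).symm
  obtain ⟨φ, hφ, hae⟩ := (tendstoInMeasure_of_tendsto_eLpNorm (by simpa using hp)
    (fun n => AEEqFun.aestronglyMeasurable _) (AEEqFun.aestronglyMeasurable _)
    h0).exists_seq_tendsto_ae
  have hall : ∀ᵐ t ∂μ, ∀ n, (hX.inclusion (u n) : Ω →ₘ[μ] ℂ) t = u n t :=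
    ae_all_iff.2 fun n => hX.coe_inclusion (u n)
  refine hX.eq_inclusion ?_
  filter_upwards [hae, hall] with t h1 h2
  have h3 : Tendsto (fun n => u n t) atTop (𝓝 (b t)) :=
    (ZeroAtInftyContinuousMap.tendsto_iff_tendstoUniformly.1 hu).tendsto_at t
  refine tendsto_nhds_unique h1 ?_
  simp only [h2]
  exact h3.comp hφ.tendsto_atTop

/-- Shapiro's Theorem for rational functions follows from the existence of continuous functions
that are uniformly far from rational functions of degree `n` in the metric of `L_p`. -/
theorem IsBetweenC0AndLp.satisfiesShapiro (hX : IsBetweenC0AndLp μ p X N) (hp : 0 < p) {z : Ω → ℂ}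
    (hfar : ∃ c > 0, ∀ n, ∃ f : C₀(Ω, ℂ), ‖f‖ ≤ 1 ∧ ∀ g ∈ ratFunctions z n,
      ENNReal.ofReal c ≤ eLpNorm (⇑f - g) (ENNReal.ofReal p) μ) (k : ℕ) :
    SatisfiesShapiro N (fun n => elementsIn X (ratFunctions z (k * n))) := by
  obtain ⟨C, -, hC⟩ := hX.exists_bound hp
  obtain ⟨C', hC'1, hC'⟩ := hX.exists_one_le
  obtain ⟨c, hc, hfar⟩ := hfar
  refine satisfiesShapiro_of_bound hX.quasiBanach.toIsQuasiNorm hX.inclusion hC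
    (fun n => zero_mem_elementsIn (zero_mem_ratFunctions z _))
    (fun n c x hx => smul_mem_elementsIn_ratFunctions c hx)
    ⟨fun n => 2 * n, fun n x hx y hy => add_mem_elementsIn_ratFunctions (by lia) hx hy⟩
    ⟨c / C', by positivity, fun n => ?_⟩
  obtain ⟨f, hf1, hf⟩ := hfar (k * n)
  refine ⟨f, hf1, fun a ⟨g, hg, ha⟩ => ?_⟩
  have h1 := hf g hg
  rw [eLpNorm_congr_ae (coe_sub_ae (hX.coe_inclusion f) ha).symm] at h1
  have h2 := h1.trans (hC' _)
  rw [div_le_iff₀' (by positivity)]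
  exact (ENNReal.ofReal_le_ofReal_iff'.1 h2).resolve_right (not_le.2 hc)

/-- Criterion for the rational functions of degrees `d n` to be an approximation scheme. Degrees
are strictly increasing because of functions in `C₀` with a pole of maximal order. -/
theorem IsBetweenC0AndLp.isApproximationScheme (hX : IsBetweenC0AndLp μ p X N) (hp : 0 < p)
    (hμ : μ ≠ 0) {z : Ω → ℂ} (hz : ∀ ζ, μ (z ⁻¹' {ζ}) = 0) {d : ℕ → ℕ} (hd : StrictMono d)
    (hdK : ∃ K : ℕ → ℕ, ∀ n, n ≤ K n ∧ 2 * d n ≤ d (K n)) {w : ℂ} (hw : ∀ t, z t ≠ w)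
    (hpole : ∀ n, ∃ r : ℂ[X], r.natDegree ≤ d (n + 1) ∧ r.eval w ≠ 0 ∧
      ∃ f : C₀(Ω, ℂ), ∀ t, f t = r.eval (z t) / (z t - w) ^ d (n + 1))
    (hdense : ∀ x : X, ∀ ε > 0, ∃ (f : C₀(Ω, ℂ)) (y : X), (y : Ω →ₘ[μ] ℂ) =ᵐ[μ] f ∧
      N (x - y) < ε ∧ ∀ δ > 0, ∃ g : C₀(Ω, ℂ), ‖f - g‖ ≤ δ ∧ ∃ n, ⇑g ∈ ratFunctions z n) :
    IsApproximationScheme N (fun n => elementsIn X (ratFunctions z (d n))) where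
  strict n := by
    refine ⟨elementsIn_ratFunctions_mono (hd n.lt_succ_self).le, fun hsub => ?_⟩
    obtain ⟨r, hr, hrw, f, hf⟩ := hpole n
    have hmem : hX.inclusion f ∈ elementsIn X (ratFunctions z (d (n + 1))) := by
      refine ⟨f, ⟨r, (Polynomial.X - C w) ^ d (n + 1), hr, ?_, fun t => ?_, fun t => ?_⟩,
        hX.coe_inclusion f⟩
      · rw [natDegree_pow, natDegree_X_sub_C, mul_one]
      · simpa using fun h => absurd h (sub_ne_zero.2 (hw t))
      · simp [hf]
    obtain ⟨g, hg, hae⟩ := hsub hmem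
    have hae' : ∀ᵐ t ∂μ, t ∈ {t | g t = f t} := hae.symm.trans (hX.coe_inclusion f)
    obtain ⟨t, ht, hne⟩ := ne_of_mem_ratFunctions (infinite_image_of_ae hμ hz hae') hrw hw
      (hd n.lt_succ_self) hg
    exact hne (ht.trans (hf t))
  add_subset := by
    obtain ⟨K, hK⟩ := hdK
    exact ⟨K, fun n => ⟨(hK n).1, fun x hx y hy =>
      add_mem_elementsIn_ratFunctions (hK n).2 hx hy⟩⟩
  smul_mem n c x hx := smul_mem_elementsIn_ratFunctions c hx
  dense x ε hε := by
    obtain ⟨C, hC0, hC⟩ := hX.exists_bound hp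
    obtain ⟨η, hη, happrox⟩ :=
      exists_quasiNorm_sub_lt hX.quasiBanach.toIsQuasiNorm hC0 hC hε
    obtain ⟨f, y, hy, hxy, happ⟩ := hdense x η hη
    obtain ⟨g, hfg, n, hg⟩ := happ η hη
    rw [← hX.eq_inclusion hy] at hxy
    exact ⟨n, hX.inclusion g, elementsIn_ratFunctions_mono (hd.id_le n)
      ⟨g, hg, hX.coe_inclusion g⟩, happrox x f hxy g hfg⟩

end BetweenC0AndLp

/-! ### Continuous functions far from rational functions -/

section LowerBounds

open scoped ZeroAtInfty

/-- The restriction to `I` of a continuous function that is small, on `I`, off compact subsets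
of `I`. -/
def restrictC0 (I : Set ℝ) (g : ℝ → ℂ) (hg : Continuous g)
    (h : ∀ ε > 0, ∃ K ⊆ I, IsCompact K ∧ ∀ t ∈ I, t ∉ K → ‖g t‖ < ε) : C₀(I, ℂ) where
  toFun t := g t
  continuous_toFun := hg.comp continuous_subtype_val
  zero_at_infty' := by
    rw [Metric.tendsto_nhds]
    intro ε hε
    obtain ⟨K, hKI, hK, hsmall⟩ := h ε hε
    have hK' : IsCompact (Subtype.val ⁻¹' K : Set I) := by
      rw [Subtype.isCompact_iff, Subtype.image_preimage_coe, Set.inter_eq_self_of_subset_right hKI]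
      exact hK
    filter_upwards [hK'.compl_mem_cocompact] with t ht
    rw [dist_zero_right]
    exact hsmall t t.2 ht

theorem norm_C0_le {Ω : Type*} [TopologicalSpace Ω] {f : C₀(Ω, ℂ)} {c : ℝ} (hc : 0 ≤ c)
    (h : ∀ t, ‖f t‖ ≤ c) : ‖f‖ ≤ c := by
  rw [← ZeroAtInftyContinuousMap.norm_toBCF_eq_norm]
  exact (BoundedContinuousFunction.norm_le hc).2 h

theorem lebesgueOn_preimage {I : Set ℝ} (hI : I.OrdConnected) (S : Set ℝ) (hS : S ⊆ I) :
    lebesgueOn I (Subtype.val ⁻¹' S) = volume S := by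
  rw [lebesgueOn, comap_subtype_coe_apply hI.measurableSet, Subtype.image_preimage_coe,
    Set.inter_eq_self_of_subset_right hS]

/-- With `4n + 1` periods and at most `2n` zeros, the bound of `volume_far_from_sine` is at least
a sixth of the length of the interval. -/
theorem le_ofReal_period_bound {u v : ℝ} (huv : u < v) (n : ℕ) :
    ENNReal.ofReal ((v - u) / 6) ≤
      ENNReal.ofReal ((((4 * n + 1 : ℕ) : ℝ) - (2 * n : ℕ)) * ((v - u) / (4 * n + 1 : ℕ) / 3)) := by
  refine ENNReal.ofReal_le_ofReal ?_
  have hvu : 0 < v - u := sub_pos.2 huv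
  push_cast
  rw [div_div, mul_div_assoc', div_le_div_iff₀ (by norm_num) (by positivity)]
  have : (0 : ℝ) ≤ n := n.cast_nonneg
  nlinarith [mul_nonneg this hvu.le]

/-- On an interval, a sine wave with `4n + 1` periods is far in `L_p` from every rational function
of degree `n`. -/
theorem exists_C0_far_of_interval {p : ℝ} (hp : 0 < p) {I : Set ℝ} (hI : I.OrdConnected) {u v : ℝ}
    (huv : u < v) (huvI : Set.Icc u v ⊆ I) {z : ℝ → ℂ} (hz : Continuous z)
    (hz' : (∀ t, (z t).im = 0) ∨ ∀ t, ‖z t‖ = 1) (hinj : Set.InjOn z (Set.Ioo u v)) (n : ℕ) :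
    ∃ f : C₀(I, ℂ), ‖f‖ ≤ 1 ∧ ∀ g ∈ ratFunctions (fun t : I => z t) n,
      ENNReal.ofReal (1 / 2 * ((v - u) / 6) ^ (1 / p)) ≤
        eLpNorm (⇑f - g) (ENNReal.ofReal p) (lebesgueOn I) := by
  have hvu : 0 < v - u := sub_pos.2 huv
  set M : ℕ := 4 * n + 1 with hM
  set s : ℝ → ℝ := fun t => Real.sin (2 * Real.pi * (M * (t - u) / (v - u))) with hs
  have hsc : Continuous s := by fun_prop
  set φ : ℝ → ℝ := fun t => s (max u (min v t)) with hφ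
  have hφc : Continuous φ := hsc.comp (by fun_prop)
  have hφ_in : ∀ t ∈ Set.Icc u v, φ t = s t := fun t ht => by
    simp only [hφ]; rw [min_eq_right ht.2, max_eq_right ht.1]
  have hsu : s u = 0 := by simp [hs]
  have hsv : s v = 0 := by
    simp only [hs]
    rw [mul_div_assoc, div_self hvu.ne', mul_one,
      show 2 * Real.pi * (M : ℝ) = ((2 * M : ℕ) : ℝ) * Real.pi by push_cast; ring]
    exact Real.sin_nat_mul_pi _
  have hφ_out : ∀ t, t ∉ Set.Icc u v → φ t = 0 := by
    intro t ht
    rcases lt_or_ge t u with h | h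
    · simp only [hφ]; rw [max_eq_left ((min_le_right _ _).trans h.le), hsu]
    · have h' : v < t := not_le.1 fun h' => ht ⟨h, h'⟩
      simp only [hφ]; rw [min_eq_left h'.le, max_eq_right huv.le, hsv]
  let f : C₀(I, ℂ) := restrictC0 I (fun t => (φ t : ℂ)) (by fun_prop) fun ε hε =>
    ⟨Set.Icc u v, huvI, isCompact_Icc, fun t _ ht => by simpa [hφ_out t ht] using hε⟩
  have hf : ∀ t : I, f t = (φ t : ℂ) := fun t => rfl
  refine ⟨f, norm_C0_le zero_le_one fun t => ?_, fun g hg => ?_⟩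
  · rw [hf, Complex.norm_real]
    exact Real.abs_sin_le_one _
  have hgc : Continuous g := continuous_of_mem_ratFunctions (hz.comp continuous_subtype_val) hg
  refine ofReal_le_eLpNorm_of_le_measure hp (f.continuous.sub hgc).aestronglyMeasurable
    (by norm_num) (by positivity) ?_
  set ρ : ℝ → ℝ := fun t => (Function.extend Subtype.val g 0 t).re with hρ
  have hρI : ∀ t : I, ρ t = (g t).re := fun t => by
    simp only [hρ]; rw [Subtype.val_injective.extend_apply]
  have hρc : ContinuousOn ρ (Set.Ioo u v) := by
    have : ContinuousOn ρ I := by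
      rw [continuousOn_iff_continuous_domRestrict]
      refine (Complex.continuous_re.comp hgc).congr fun t => (hρI t).symm
    exact this.mono (Set.Ioo_subset_Icc_self.trans huvI)
  have hzero : (∀ t ∈ Set.Ioo u v, ρ t = 0) ∨
      ∃ Z : Finset ℂ, Z.card ≤ 2 * n ∧ ∀ t ∈ Set.Ioo u v, ρ t = 0 → z t ∈ Z := by
    have hmem : ∀ t ∈ Set.Ioo u v, t ∈ I := fun t ht => huvI (Set.Ioo_subset_Icc_self ht)
    rcases re_ratFunction_zeros (hz'.imp (fun h t => h _) fun h t => h _) hg with h | ⟨Z, hZ, h⟩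
    · exact Or.inl fun t ht => (hρI ⟨t, hmem t ht⟩).trans (h _)
    · exact Or.inr ⟨Z, hZ, fun t ht h0 => h ⟨t, hmem t ht⟩ ((hρI ⟨t, hmem t ht⟩).symm.trans h0)⟩
  refine (le_ofReal_period_bound huv n).trans
    ((volume_far_from_sine huv (by omega) hρc hinj hzero).trans ?_)
  rw [← lebesgueOn_preimage hI _ (fun t ht => huvI (Set.Ioo_subset_Icc_self ht.1))]
  refine measure_mono fun t ht => ?_
  obtain ⟨ht1, ht2⟩ := ht
  refine ht2.trans ?_
  rw [hρI]
  have h1 : s t = (f t).re := by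
    rw [hf, Complex.ofReal_re, hφ_in _ (Set.Ioo_subset_Icc_self ht1)]
  have h2 := Complex.abs_re_le_norm ((⇑f - g) t)
  rw [Pi.sub_apply, Complex.sub_re, ← h1] at h2
  exact h2

theorem exp_I_mul_injOn {u v : ℝ} (h : v - u ≤ 2 * Real.pi) :
    Set.InjOn (fun t : ℝ => Complex.exp (Complex.I * (t : ℂ))) (Set.Ioo u v) := by
  intro s hs t ht hst
  obtain ⟨n, hn⟩ := Complex.exp_eq_exp_iff_exists_int.1 hst
  have h1 : (s : ℂ) = t + n * (2 * Real.pi) := by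
    have := Complex.I_ne_zero
    apply mul_left_cancel₀ this
    rw [hn]; ring
  have h2 : s = t + n * (2 * Real.pi) := by exact_mod_cast h1
  have hpi := Real.two_pi_pos
  have h3 : |(n : ℝ)| < 1 := by
    have : |(n : ℝ) * (2 * Real.pi)| < 2 * Real.pi := by
      rw [abs_lt]; constructor <;> linarith [hs.1, hs.2, ht.1, ht.2]
    rw [abs_mul, abs_of_pos hpi] at this
    by_contra! h
    nlinarith
  have h4 : n = 0 := by
    have : |n| < 1 := by exact_mod_cast h3
    exact Int.abs_lt_one_iff.1 this
  simpa [h4] using h2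

theorem continuous_exp_I_mul : Continuous fun t : ℝ => Complex.exp (Complex.I * (t : ℂ)) := by
  fun_prop

theorem norm_exp_I_mul (t : ℝ) : ‖Complex.exp (Complex.I * (t : ℂ))‖ = 1 := by
  rw [mul_comm]; exact Complex.norm_exp_ofReal_mul_I t

/-- On the unit circle, `- i w ^ M` with `M = 4n + 1` has the real part `sin (M θ)`, so its
difference with a rational function of degree `n` is large on a large set. -/
theorem volume_far_from_monomial {g : ℝ → ℂ} (hg : Continuous g) {n : ℕ}
    (hmem : g ∈ ratFunctions (fun t : ℝ => Complex.exp (Complex.I * (t : ℂ))) n) :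
    ENNReal.ofReal (2 * Real.pi / 6) ≤ volume {t ∈ Set.Ioo 0 (2 * Real.pi) |
      1 / 2 ≤ ‖-Complex.I * Complex.exp (Complex.I * (t : ℂ)) ^ (4 * n + 1) - g t‖} := by
  have huv : 0 < 2 * Real.pi := Real.two_pi_pos
  have h0 := le_ofReal_period_bound huv n
  rw [sub_zero] at h0
  have hzero : (∀ t ∈ Set.Ioo 0 (2 * Real.pi), (g t).re = 0) ∨
      ∃ Z : Finset ℂ, Z.card ≤ 2 * n ∧ ∀ t ∈ Set.Ioo 0 (2 * Real.pi), (g t).re = 0 →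
        Complex.exp (Complex.I * (t : ℂ)) ∈ Z := by
    rcases re_ratFunction_zeros (Or.inr norm_exp_I_mul) hmem with h | ⟨Z, hZ, h⟩
    · exact Or.inl fun t _ => h t
    · exact Or.inr ⟨Z, hZ, fun t _ => h t⟩
  have h1 := volume_far_from_sine (M := 4 * n + 1) huv (by omega)
    (Complex.continuous_re.comp hg).continuousOn (exp_I_mul_injOn (by simp)) hzero
  rw [sub_zero] at h1
  refine h0.trans (h1.trans (measure_mono fun t ht => ⟨ht.1, ht.2.trans ?_⟩))
  refine le_trans (le_of_eq ?_) (Complex.abs_re_le_norm _)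
  have hre : (-Complex.I * Complex.exp (Complex.I * (t : ℂ)) ^ (4 * n + 1)).re
      = Real.sin (2 * Real.pi * ((4 * n + 1 : ℕ) * (t - 0) / (2 * Real.pi))) := by
    rw [← Complex.exp_nat_mul, show ((4 * n + 1 : ℕ) : ℂ) * (Complex.I * (t : ℂ))
      = ((((4 * n + 1 : ℕ) : ℝ) * t : ℝ) : ℂ) * Complex.I by push_cast; ring, neg_mul,
      Complex.neg_re, Complex.I_mul_re, Complex.exp_ofReal_mul_I_im, neg_neg]
    congr 1
    field_simp
    ring
  rw [Complex.sub_re, hre, sub_zero]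
  rfl

/-- A space `Ω` with a coordinate `z` on the unit circle, parametrized by `[0, 2π]` through `τ`,
carries continuous functions that are far in `L_p` from all rational functions of degree `n`. -/
theorem exists_C0_far_of_circle {p : ℝ} (hp : 0 < p) {Ω : Type*} [TopologicalSpace Ω]
    [CompactSpace Ω] [MeasurableSpace Ω] [BorelSpace Ω] {μ : Measure Ω} {z : Ω → ℂ}
    (hz : Continuous z) {τ : ℝ → Ω} (hτ : Continuous τ)
    (hτμ : Measure.map τ (volume.restrict (Set.Ioc 0 (2 * Real.pi))) = μ)
    (hzτ : ∀ t, z (τ t) = Complex.exp (Complex.I * (t : ℂ))) (hz1 : ∀ x, ‖z x‖ = 1) (n : ℕ) :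
    ∃ f : C₀(Ω, ℂ), ‖f‖ ≤ 1 ∧ ∀ g ∈ ratFunctions z n,
      ENNReal.ofReal (1 / 2 * (2 * Real.pi / 6) ^ (1 / p)) ≤
        eLpNorm (⇑f - g) (ENNReal.ofReal p) μ := by
  have hfc : Continuous fun x => -Complex.I * z x ^ (4 * n + 1) := by fun_prop
  let f : C₀(Ω, ℂ) := ⟨⟨fun x => -Complex.I * z x ^ (4 * n + 1), hfc⟩, by simp⟩
  have hf : ∀ x, f x = -Complex.I * z x ^ (4 * n + 1) := fun x => rfl
  refine ⟨f, norm_C0_le zero_le_one fun x => ?_, fun g hg => ?_⟩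
  · rw [hf]; simp [hz1]
  have hgc := continuous_of_mem_ratFunctions hz hg
  refine ofReal_le_eLpNorm_of_le_measure hp (hfc.sub hgc).stronglyMeasurable.aestronglyMeasurable
    (by norm_num) (by positivity) ?_
  have hclosed : IsClosed {x | 1 / 2 ≤ ‖(⇑f - g) x‖} :=
    isClosed_le continuous_const (hfc.sub hgc).norm
  have hgτ : g ∘ τ ∈ ratFunctions (fun t : ℝ => Complex.exp (Complex.I * (t : ℂ))) n := by
    obtain ⟨P, Q, hP, hQ, hQ0, hg⟩ := hg
    refine ⟨P, Q, hP, hQ, fun t => ?_, fun t => ?_⟩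
    · simpa only [← hzτ] using hQ0 _
    · simpa only [← hzτ, Function.comp_apply] using hg (τ t)
  refine (volume_far_from_monomial (hgc.comp hτ) hgτ).trans ?_
  change _ ≤ μ {x | 1 / 2 ≤ ‖(⇑f - g) x‖}
  rw [← hτμ, Measure.map_apply hτ.measurable hclosed.measurableSet,
    Measure.restrict_apply (hτ.measurable hclosed.measurableSet)]
  refine measure_mono fun t ht => ⟨?_, Set.Ioo_subset_Ioc_self ht.1⟩
  have h2 := ht.2
  rw [← hzτ] at h2
  exact h2

end LowerBounds

/-! ### Uniform approximation by rational functions on intervals and circles -/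

section Density

open scoped ZeroAtInfty

section Interval

variable {I : Set ℝ} {c d : ℝ}

/-- A `C₀` function on a set `I` of real numbers is small near a point outside `I`. -/
theorem exists_small_near_of_notMem (f : C₀(I, ℂ)) {ε : ℝ} (hε : 0 < ε) {e : ℝ} (he : e ∉ I) :
    ∃ η > 0, ∀ t : I, |(t : ℝ) - e| ≤ η → ‖f t‖ ≤ ε := by
  have h := (Metric.tendsto_nhds.1 f.zero_at_infty') ε hε
  obtain ⟨K, hK, hKs⟩ := mem_cocompact.1 h
  have hK' : IsClosed (Subtype.val '' K : Set ℝ) := (hK.image continuous_subtype_val).isClosed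
  have heK : e ∈ (Subtype.val '' K : Set ℝ)ᶜ := by
    rintro ⟨t, -, rfl⟩
    exact he t.2
  obtain ⟨η, hη, hball⟩ := Metric.isOpen_iff.1 hK'.isOpen_compl e heK
  refine ⟨η / 2, by positivity, fun t ht => ?_⟩
  have h1 : (t : ℝ) ∈ Metric.ball e η := by
    rw [Metric.mem_ball, Real.dist_eq]; linarith
  have h2 : t ∈ Kᶜ := fun htK => hball h1 ⟨t, htK, rfl⟩
  have h3 := hKs h2
  rw [Set.mem_ofPred_eq, dist_zero_right] at h3
  exact h3.le

/-- A `C₀` function on a bounded interval, extended by zero, is uniformly close on the closed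
interval to a continuous function on the line. -/
theorem exists_continuous_near_extend (hcd : c < d) (hI₁ : Set.Ioo c d ⊆ I)
    (f : C₀(I, ℂ)) {ε : ℝ} (hε : 0 < ε) :
    ∃ F : ℝ → ℂ, Continuous F ∧
      ∀ t ∈ Set.Icc c d, ‖F t - Function.extend Subtype.val f 0 t‖ ≤ ε := by
  set h : ℝ → ℂ := Function.extend Subtype.val f 0 with hh
  have hhI : ∀ t (ht : t ∈ I), h t = f ⟨t, ht⟩ := fun t ht =>
    Subtype.val_injective.extend_apply f 0 ⟨t, ht⟩
  have hhO : ∀ t, t ∉ I → h t = 0 := fun t ht =>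
    Function.extend_apply' _ _ _ (by rintro ⟨s, rfl⟩; exact ht s.2)
  have hcont : ContinuousOn h I := by
    rw [continuousOn_iff_continuous_domRestrict]
    exact f.continuous.congr fun t => (hhI t t.2).symm
  have hsmall : ∀ e, e ∉ I → ∃ η > 0, ∀ t, |t - e| ≤ η → ‖h t‖ ≤ ε / 2 := by
    intro e he
    obtain ⟨η, hη, hs⟩ := exists_small_near_of_notMem f (half_pos hε) he
    refine ⟨η, hη, fun t ht => ?_⟩
    by_cases htI : t ∈ I
    · rw [hhI t htI]; exact hs ⟨t, htI⟩ ht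
    · rw [hhO t htI, norm_zero]; positivity
  have hleft : ∃ c' ∈ I, c ≤ c' ∧ c' < (c + d) / 2 ∧
      ∀ t ∈ Set.Icc c d, t < c' → ‖h c' - h t‖ ≤ ε := by
    by_cases hc : c ∈ I
    · exact ⟨c, hc, le_rfl, by linarith, fun t ht htc => absurd ht.1 (not_le.2 htc)⟩
    · obtain ⟨η, hη, hs⟩ := hsmall c hc
      have h1 : 0 < min η ((d - c) / 3) := lt_min hη (by linarith)
      have h2 := min_le_right η ((d - c) / 3)
      have h3 := min_le_left η ((d - c) / 3)
      refine ⟨c + min η ((d - c) / 3), hI₁ ⟨by linarith, by linarith⟩, by linarith, by linarith,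
        fun t ht htc => (norm_sub_le _ _).trans ?_⟩
      have h4 := hs (c + min η ((d - c) / 3)) (by rw [add_sub_cancel_left, abs_of_pos h1]; exact h3)
      have h5 := hs t (by rw [abs_of_nonneg (by linarith [ht.1])]; linarith)
      linarith
  have hright : ∃ d' ∈ I, d' ≤ d ∧ (c + d) / 2 < d' ∧
      ∀ t ∈ Set.Icc c d, d' < t → ‖h d' - h t‖ ≤ ε := by
    by_cases hd : d ∈ I
    · exact ⟨d, hd, le_rfl, by linarith, fun t ht htc => absurd ht.2 (not_le.2 htc)⟩
    · obtain ⟨η, hη, hs⟩ := hsmall d hd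
      have h1 : 0 < min η ((d - c) / 3) := lt_min hη (by linarith)
      have h2 := min_le_right η ((d - c) / 3)
      have h3 := min_le_left η ((d - c) / 3)
      refine ⟨d - min η ((d - c) / 3), hI₁ ⟨by linarith, by linarith⟩, by linarith, by linarith,
        fun t ht htc => (norm_sub_le _ _).trans ?_⟩
      have h4 := hs (d - min η ((d - c) / 3)) (by
        rw [sub_sub_cancel_left, abs_neg, abs_of_pos h1]; exact h3)
      have h5 := hs t (by rw [abs_of_nonpos (by linarith [ht.2])]; linarith)
      linarith
  obtain ⟨c', hc'I, hc', hc'm, hl⟩ := hleft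
  obtain ⟨d', hd'I, hd', hd'm, hr⟩ := hright
  have hsub : Set.Icc c' d' ⊆ I := by
    intro t ht
    rcases eq_or_lt_of_le ht.1 with rfl | h1
    · exact hc'I
    rcases eq_or_lt_of_le ht.2 with rfl | h2
    · exact hd'I
    exact hI₁ ⟨hc'.trans_lt h1, h2.trans_le hd'⟩
  have hcd' : c' ≤ d' := by linarith
  refine ⟨fun t => h (max c' (min d' t)), hcont.comp_continuous (by fun_prop)
    (fun t => hsub ⟨le_max_left _ _, max_le hcd' (min_le_left _ _)⟩), fun t ht => ?_⟩
  simp only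
  rcases lt_or_ge t c' with h1 | h1
  · rw [min_eq_right (h1.le.trans hcd'), max_eq_left h1.le]
    exact hl t ht h1
  rcases lt_or_ge d' t with h2 | h2
  · rw [min_eq_left h2.le, max_eq_right hcd']
    exact hr t ht h2
  · rw [min_eq_right h2, max_eq_right h1, sub_self, norm_zero]
    exact hε.le

/-- A continuous function that vanishes at those end points of a bounded interval `I` which do not
belong to `I` restricts to a `C₀` function on `I`. -/
theorem exists_C0_eq_of_endpoints (hI₁ : Set.Ioo c d ⊆ I) (hI₂ : I ⊆ Set.Icc c d) {g : ℝ → ℂ}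
    (hg : ContinuousOn g (Set.Icc c d)) (hc : c ∉ I → g c = 0) (hd : d ∉ I → g d = 0) :
    ∃ f : C₀(I, ℂ), ∀ t : I, f t = g t := by
  rcases le_or_gt c d with hcd | hcd
  · have hext : Continuous (Set.IccExtend hcd ((Set.Icc c d).domRestrict g)) :=
      (continuousOn_iff_continuous_domRestrict.1 hg).Icc_extend'
    have heq : ∀ t ∈ Set.Icc c d, Set.IccExtend hcd ((Set.Icc c d).domRestrict g) t = g t :=
      fun t ht => Set.IccExtend_of_mem hcd _ ht
    refine ⟨restrictC0 I _ hext fun ε hε =>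
      ⟨{t ∈ Set.Icc c d | ε ≤ ‖Set.IccExtend hcd ((Set.Icc c d).domRestrict g) t‖}, ?_, ?_, ?_⟩,
      fun t => heq t (hI₂ t.2)⟩
    · rintro t ⟨ht, hεt⟩
      rw [heq t ht] at hεt
      by_contra htI
      have h0 : g t = 0 := by
        rcases eq_or_lt_of_le ht.1 with rfl | h1
        · exact hc htI
        rcases eq_or_lt_of_le ht.2 with rfl | h2
        · exact hd htI
        exact absurd (hI₁ ⟨h1, h2⟩) htI
      rw [h0, norm_zero] at hεt
      linarith
    · exact isCompact_Icc.inter_right (isClosed_le continuous_const hext.norm)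
    · intro t ht htK
      by_contra! h
      exact htK ⟨hI₂ ht, h⟩
  · have : IsEmpty I := ⟨fun t => by
      have h := hI₂ t.2
      rwa [Set.Icc_eq_empty (not_le.2 hcd)] at h⟩
    exact ⟨0, fun t => this.elim t⟩

/-- If the extension by zero of a `C₀` function is approximated on the closed interval by functions
from `W`, then subtracting an interpolating affine function of the coordinate `z` gives
approximants which vanish at the missing end points. -/
theorem exists_C0_near_of_approx (hcd : c < d) (hI₁ : Set.Ioo c d ⊆ I) (hI₂ : I ⊆ Set.Icc c d)
    {z : ℝ → ℂ} (hz : Continuous z) {W : Set (ℝ → ℂ)} (hWc : ∀ P ∈ W, Continuous P)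
    (hWsub : ∀ P ∈ W, ∀ α β : ℂ, (fun t => P t - (α + β * z t)) ∈ W)
    (hWeq : z c = z d → ∀ P ∈ W, P c = P d) (f : C₀(I, ℂ))
    (happ : ∀ ε > 0, ∃ P ∈ W, ∀ t ∈ Set.Icc c d, ‖P t - Function.extend Subtype.val f 0 t‖ ≤ ε)
    {δ : ℝ} (hδ : 0 < δ) :
    ∃ g : C₀(I, ℂ), ‖f - g‖ ≤ δ ∧ ∃ P ∈ W, ∀ t : I, g t = P t := by
  have hc_mem : c ∈ Set.Icc c d := Set.left_mem_Icc.2 hcd.le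
  have hd_mem : d ∈ Set.Icc c d := Set.right_mem_Icc.2 hcd.le
  have hO : ∀ t, t ∉ I → Function.extend Subtype.val (⇑f) 0 t = 0 := fun t ht =>
    Function.extend_apply' _ _ _ (by rintro ⟨s, rfl⟩; exact ht s.2)
  -- affine functions of `z` that interpolate `P` at the missing end points
  have hinterp : ∃ B : ℝ, 0 ≤ B ∧ ∀ P ∈ W, ∀ ε : ℝ, 0 ≤ ε → (c ∉ I → ‖P c‖ ≤ ε) →
      (d ∉ I → ‖P d‖ ≤ ε) → ∃ α β : ℂ, (c ∉ I → α + β * z c = P c) ∧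
        (d ∉ I → α + β * z d = P d) ∧ ∀ t ∈ Set.Icc c d, ‖α + β * z t‖ ≤ B * ε := by
    -- the case `z c = z d` occurs for the coordinate `e^{it}` on a full period
    by_cases hzz : z c = z d
    · refine ⟨1, zero_le_one, fun P hP ε hε hPc hPd => ?_⟩
      have hPcd := hWeq hzz P hP
      by_cases hmiss : c ∈ I ∧ d ∈ I
      · exact ⟨0, 0, fun h => absurd hmiss.1 h, fun h => absurd hmiss.2 h, fun t _ => by simpa⟩
      · refine ⟨P c, 0, fun _ => by simp, fun _ => by simp [hPcd], fun t _ => ?_⟩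
        rw [zero_mul, add_zero, one_mul]
        by_cases hc : c ∈ I
        · rw [hPcd]; exact hPd fun hd => hmiss ⟨hc, hd⟩
        · exact hPc hc
    · obtain ⟨R, hR⟩ := (isCompact_Icc (a := c) (b := d)).exists_bound_of_continuousOn
        hz.continuousOn
      have hzd : z c - z d ≠ 0 := sub_ne_zero.2 hzz
      have hR0 : 0 ≤ R := (norm_nonneg _).trans (hR c hc_mem)
      refine ⟨4 * R / ‖z c - z d‖, by positivity, fun P hP ε hε hPc hPd => ?_⟩
      classical
      obtain ⟨u, hu, huε⟩ : ∃ u : ℂ, (c ∉ I → u = P c) ∧ ‖u‖ ≤ ε := by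
        by_cases hc : c ∈ I
        · exact ⟨0, fun h => absurd hc h, by simpa⟩
        · exact ⟨P c, fun _ => rfl, hPc hc⟩
      obtain ⟨v, hv, hvε⟩ : ∃ v : ℂ, (d ∉ I → v = P d) ∧ ‖v‖ ≤ ε := by
        by_cases hd : d ∈ I
        · exact ⟨0, fun h => absurd hd h, by simpa⟩
        · exact ⟨P d, fun _ => rfl, hPd hd⟩
      refine ⟨(v * z c - u * z d) / (z c - z d), (u - v) / (z c - z d), fun hc => ?_, fun hd => ?_,
        fun t ht => ?_⟩
      · rw [← hu hc]; field_simp; ring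
      · rw [← hv hd]; field_simp; ring
      · have h1 : (v * z c - u * z d) / (z c - z d) + (u - v) / (z c - z d) * z t
            = (u * (z t - z d) + v * (z c - z t)) / (z c - z d) := by
          field_simp; ring
        rw [h1, norm_div, div_mul_eq_mul_div]
        gcongr
        have h2 : ‖z t - z d‖ ≤ 2 * R :=
          (norm_sub_le _ _).trans (by linarith [hR t ht, hR d hd_mem])
        have h3 : ‖z c - z t‖ ≤ 2 * R :=
          (norm_sub_le _ _).trans (by linarith [hR t ht, hR c hc_mem])
        calc ‖u * (z t - z d) + v * (z c - z t)‖
            ≤ ‖u‖ * ‖z t - z d‖ + ‖v‖ * ‖z c - z t‖ := by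
              rw [← norm_mul, ← norm_mul]; exact norm_add_le _ _
          _ ≤ ε * (2 * R) + ε * (2 * R) := by gcongr
          _ = 4 * R * ε := by ring
  obtain ⟨B, hB, hinterp⟩ := hinterp
  obtain ⟨P, hP, hPf⟩ := happ (δ / (1 + B)) (by positivity)
  obtain ⟨α, β, hαc, hαd, hαβ⟩ := hinterp P hP (δ / (1 + B)) (by positivity)
    (fun hc => by simpa [hO c hc] using hPf c hc_mem)
    (fun hd => by simpa [hO d hd] using hPf d hd_mem)
  have hP' := hWsub P hP α β
  obtain ⟨g, hg⟩ := exists_C0_eq_of_endpoints hI₁ hI₂ (hWc _ hP').continuousOn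
    (fun hc => by rw [hαc hc, sub_self]) (fun hd => by rw [hαd hd, sub_self])
  refine ⟨g, norm_C0_le hδ.le fun t => ?_, _, hP', hg⟩
  have h1 := hPf t (hI₂ t.2)
  rw [Subtype.val_injective.extend_apply] at h1
  have h2 := hαβ t (hI₂ t.2)
  rw [ZeroAtInftyContinuousMap.sub_apply, hg]
  calc ‖f t - (P t - (α + β * z t))‖ = ‖(α + β * z t) - (P t - f t)‖ := by congr 1; ring
    _ ≤ B * (δ / (1 + B)) + δ / (1 + B) := (norm_sub_le _ _).trans (add_le_add h2 h1)
    _ = δ := by field_simp; ring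

/-- Weierstrass approximation for complex valued functions. -/
theorem exists_polynomial_near_complex {F : ℝ → ℂ} (hF : Continuous F) {ε : ℝ} (hε : 0 < ε) :
    ∃ Q : ℂ[X], ∀ t ∈ Set.Icc c d, ‖Q.eval (t : ℂ) - F t‖ ≤ ε := by
  obtain ⟨A, hA⟩ := exists_polynomial_near_of_continuousOn c d (fun t => (F t).re)
    (Complex.continuous_re.comp hF).continuousOn (ε / 2) (by positivity)
  obtain ⟨B, hB⟩ := exists_polynomial_near_of_continuousOn c d (fun t => (F t).im)
    (Complex.continuous_im.comp hF).continuousOn (ε / 2) (by positivity)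
  refine ⟨A.map Complex.ofRealHom + C Complex.I * B.map Complex.ofRealHom, fun t ht => ?_⟩
  have hmap : ∀ D : ℝ[X], (D.map Complex.ofRealHom).eval (t : ℂ) = (D.eval t : ℝ) := fun D => by
    have := eval_map_apply (f := Complex.ofRealHom) (p := D) t
    exact this
  have h1 : (A.map Complex.ofRealHom + C Complex.I * B.map Complex.ofRealHom).eval (t : ℂ) - F t
      = ((A.eval t - (F t).re : ℝ) : ℂ) + Complex.I * ((B.eval t - (F t).im : ℝ) : ℂ) := by
    rw [eval_add, eval_mul, eval_C, hmap, hmap]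
    conv_lhs => rw [← Complex.re_add_im (F t)]
    push_cast
    ring
  rw [h1]
  refine (norm_add_le _ _).trans ?_
  rw [norm_mul, Complex.norm_I, one_mul, Complex.norm_real, Complex.norm_real]
  have := hA t ht
  have := hB t ht
  simp only [Real.norm_eq_abs]
  linarith

end Interval

section Circle

theorem torusExp_coe (t : ℝ) :
    torusExp (t : AddCircle (2 * Real.pi)) = Complex.exp (Complex.I * (t : ℂ)) := by
  rw [torusExp, AddCircle.toCircle_apply_mk, div_self Real.two_pi_pos.ne', one_mul,
    Circle.coe_exp, mul_comm]

theorem continuous_torusExp : Continuous torusExp :=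
  continuous_subtype_val.comp AddCircle.continuous_toCircle

theorem norm_torusExp (x : AddCircle (2 * Real.pi)) : ‖torusExp x‖ = 1 := Circle.norm_coe _

theorem torusExp_ne_zero (x : AddCircle (2 * Real.pi)) : torusExp x ≠ 0 := Circle.coe_ne_zero _

/-- Continuous functions on the circle are uniform limits of Laurent polynomials. -/
theorem exists_laurent_near (G : C(AddCircle (2 * Real.pi), ℂ)) {ε : ℝ} (hε : 0 < ε) :
    ∃ (Q : ℂ[X]) (m : ℕ), ∀ x, ‖Q.eval (torusExp x) / torusExp x ^ m - G x‖ ≤ ε := by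
  have hG : G ∈ (Submodule.span ℂ (Set.range (@fourier (2 * Real.pi)))).topologicalClosure := by
    rw [span_fourier_closure_eq_top]; trivial
  obtain ⟨P, hP, hGP⟩ := Metric.mem_closure_iff.1 hG ε hε
  have hform : ∃ (Q : ℂ[X]) (m : ℕ), ∀ x, P x = Q.eval (torusExp x) / torusExp x ^ m := by
    clear hGP
    induction hP using Submodule.span_induction with
    | mem P hP =>
      obtain ⟨k, rfl⟩ := hP
      refine ⟨Polynomial.X ^ (k + k.natAbs).toNat, k.natAbs, fun x => ?_⟩
      rw [fourier_apply, AddCircle.toCircle_zsmul, Circle.coe_zpow, eval_pow, eval_X,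
        eq_div_iff (pow_ne_zero _ (torusExp_ne_zero x)), torusExp, ← zpow_natCast, ← zpow_natCast,
        ← zpow_add₀ (Circle.coe_ne_zero _)]
      congr 1
      omega
    | zero => exact ⟨0, 0, fun x => by simp⟩
    | add P P' _ _ h h' =>
      obtain ⟨Q, m, h⟩ := h
      obtain ⟨Q', m', h'⟩ := h'
      refine ⟨Q * Polynomial.X ^ m' + Q' * Polynomial.X ^ m, m + m', fun x => ?_⟩
      have := torusExp_ne_zero x
      rw [ContinuousMap.add_apply, h, h']
      simp only [eval_add, eval_mul, eval_pow, eval_X]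
      field_simp
      ring
    | smul a P _ h =>
      obtain ⟨Q, m, h⟩ := h
      refine ⟨C a * Q, m, fun x => ?_⟩
      rw [ContinuousMap.smul_apply, h, eval_mul, eval_C, smul_eq_mul, mul_div_assoc]
  obtain ⟨Q, m, hQ⟩ := hform
  refine ⟨Q, m, fun x => ?_⟩
  rw [← hQ, ← dist_eq_norm, dist_comm]
  exact (ContinuousMap.dist_apply_le_dist x).trans hGP.le

theorem laurent_mem_ratFunctions {T : Type*} {z : T → ℂ} (hz : ∀ t, z t ≠ 0) (Q : ℂ[X]) (m : ℕ) :
    (fun t => Q.eval (z t) / z t ^ m) ∈ ratFunctions z (max Q.natDegree m) :=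
  ⟨Q, Polynomial.X ^ m, le_max_left _ _, by simp, fun t => by simpa using fun h => absurd h (hz t),
    fun t => by simp⟩

/-- A continuous function on an interval of length at most `2π` can be changed outside `[c, d]` so
that it becomes periodic, unless `[c, d]` is the full period and the values at its end points are
different. -/
theorem exists_periodic_near {a c d : ℝ} (hac : a ≤ c) (hcd : c < d) (hda : d ≤ a + 2 * Real.pi)
    {F : ℝ → ℂ} (hF : Continuous F) {ε : ℝ} (hε : 0 ≤ ε)
    (hend : c = a → d = a + 2 * Real.pi → ‖F c - F d‖ ≤ ε) :
    ∃ F' : ℝ → ℂ, Continuous F' ∧ F' a = F' (a + 2 * Real.pi) ∧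
      ∀ t ∈ Set.Icc c d, ‖F' t - F t‖ ≤ ε := by
  have hpi := Real.two_pi_pos
  rcases eq_or_lt_of_le hac with rfl | hac
  · rcases eq_or_lt_of_le hda with rfl | hda
    · refine ⟨fun t => F t + (F a - F (a + 2 * Real.pi)) * (((t - a) / (2 * Real.pi) : ℝ) : ℂ),
        by fun_prop, ?_, fun t ht => ?_⟩
      · simp [hpi.ne']
      · rw [add_sub_cancel_left, norm_mul, Complex.norm_real]
        have h1 : ‖(t - a) / (2 * Real.pi)‖ ≤ 1 := by
          rw [Real.norm_of_nonneg (div_nonneg (by linarith [ht.1]) hpi.le), div_le_one hpi]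
          linarith [ht.2]
        calc _ ≤ ε * 1 := by gcongr; exact hend rfl rfl
          _ = ε := mul_one ε
    · have hpos : 0 < a + 2 * Real.pi - d := by linarith
      refine ⟨fun t => F t + (F a - F (a + 2 * Real.pi)) *
        ((max 0 (1 - (a + 2 * Real.pi - t) / (a + 2 * Real.pi - d)) : ℝ) : ℂ), by fun_prop, ?_,
        fun t ht => ?_⟩
      · have h1 : 1 - (a + 2 * Real.pi - a) / (a + 2 * Real.pi - d) ≤ 0 := by
          rw [sub_nonpos, one_le_div hpos]; linarith
        simp only [max_eq_left h1, sub_self, zero_div, sub_zero, max_eq_right zero_le_one]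
        push_cast; ring
      · have h1 : 1 - (a + 2 * Real.pi - t) / (a + 2 * Real.pi - d) ≤ 0 := by
          rw [sub_nonpos, one_le_div hpos]; linarith [ht.2]
        simpa [max_eq_left h1] using hε
  · have hpos : 0 < c - a := by linarith
    refine ⟨fun t => F t + (F (a + 2 * Real.pi) - F a) *
      ((max 0 (1 - (t - a) / (c - a)) : ℝ) : ℂ), by fun_prop, ?_, fun t ht => ?_⟩
    · have h1 : 1 - (a + 2 * Real.pi - a) / (c - a) ≤ 0 := by
        rw [sub_nonpos, one_le_div hpos]; linarith
      simp only [max_eq_left h1, sub_self, zero_div, sub_zero, max_eq_right zero_le_one]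
      push_cast; ring
    · have h1 : 1 - (t - a) / (c - a) ≤ 0 := by
        rw [sub_nonpos, one_le_div hpos]; linarith [ht.1]
      simpa [max_eq_left h1] using hε

theorem exists_laurent_near_of_periodic {a : ℝ} {F : ℝ → ℂ} (hF : Continuous F)
    (hFa : F a = F (a + 2 * Real.pi)) {ε : ℝ} (hε : 0 < ε) :
    ∃ (Q : ℂ[X]) (m : ℕ), ∀ t ∈ Set.Icc a (a + 2 * Real.pi),
      ‖Q.eval (Complex.exp (Complex.I * (t : ℂ))) / Complex.exp (Complex.I * (t : ℂ)) ^ m - F t‖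
        ≤ ε := by
  obtain ⟨Q, m, hQ⟩ := exists_laurent_near
    ⟨AddCircle.liftIco (2 * Real.pi) a F, AddCircle.liftIco_continuous hFa hF.continuousOn⟩ hε
  refine ⟨Q, m, fun t ht => ?_⟩
  rcases eq_or_lt_of_le ht.2 with h | h
  · have h1 := hQ (a : AddCircle (2 * Real.pi))
    rw [ContinuousMap.coe_mk, AddCircle.liftIco_coe_apply
      ⟨le_rfl, by linarith [Real.two_pi_pos]⟩, hFa, ← AddCircle.coe_add_period, ← h,
      torusExp_coe] at h1
    exact h1
  · have h1 := hQ (t : AddCircle (2 * Real.pi))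
    rw [ContinuousMap.coe_mk, AddCircle.liftIco_coe_apply ⟨ht.1, h⟩, torusExp_coe] at h1
    exact h1

end Circle

end Density

/-! ### The theorem on intervals and circles -/

section Assembly

open scoped ZeroAtInfty

variable {p : ℝ}

theorem exists_Icc_subset_of_interior {I : Set ℝ} (h : (interior I).Nonempty) :
    ∃ u v, u < v ∧ v - u ≤ 2 * Real.pi ∧ Set.Icc u v ⊆ I := by
  obtain ⟨x, hx⟩ := h
  obtain ⟨r, hr, hball⟩ := Metric.isOpen_iff.1 isOpen_interior x hx
  have h1 : 0 < min (r / 2) 1 := lt_min (by positivity) one_pos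
  have h2 := min_le_left (r / 2) 1
  have h3 := min_le_right (r / 2) 1
  refine ⟨x - min (r / 2) 1, x + min (r / 2) 1, by linarith, ?_, fun t ht => ?_⟩
  · linarith [Real.pi_gt_three]
  · refine interior_subset (hball ?_)
    rw [Metric.mem_ball, Real.dist_eq, abs_lt]
    constructor <;> linarith [ht.1, ht.2]

theorem exists_endpoints {I : Set ℝ} (hI : I.OrdConnected) (hne : (interior I).Nonempty)
    (hb : BddBelow I) (ha : BddAbove I) :
    ∃ c d, c < d ∧ Set.Ioo c d ⊆ I ∧ I ⊆ Set.Icc c d := by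
  obtain ⟨u, v, huv, -, huvI⟩ := exists_Icc_subset_of_interior hne
  have hu := huvI (Set.left_mem_Icc.2 huv.le)
  have hv := huvI (Set.right_mem_Icc.2 huv.le)
  refine ⟨sInf I, sSup I, ?_, fun t ht => ?_, fun t ht => ⟨csInf_le hb ht, le_csSup ha ht⟩⟩
  · linarith [csInf_le hb hu, le_csSup ha hv]
  · obtain ⟨x, hx, hxt⟩ := exists_lt_of_csInf_lt ⟨u, hu⟩ ht.1
    obtain ⟨y, hy, hty⟩ := exists_lt_of_lt_csSup ⟨u, hu⟩ ht.2
    exact hI.out hx hy ⟨hxt.le, hty.le⟩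

/-- `C₀(I) ⊆ L_p(I)` is impossible on an unbounded interval: the `L_p` norm is bounded by the
supremum norm, while sine waves may have arbitrarily long supports. -/
theorem IsBetweenC0AndLp.bounded {I : Set ℝ} (hI : I.OrdConnected) (hne : (interior I).Nonempty)
    {X : Submodule ℂ (I →ₘ[lebesgueOn I] ℂ)} {N : X → ℝ}
    (hX : IsBetweenC0AndLp (lebesgueOn I) p X N) (hp : 0 < p) : BddBelow I ∧ BddAbove I := by
  obtain ⟨C, hC0, hC⟩ := hX.exists_bound hp
  obtain ⟨C', hC'1, hC'⟩ := hX.exists_one_le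
  have key : ∀ u v, u < v → Set.Icc u v ⊆ I → v - u ≤ 6 * (2 * (C' * C)) ^ p := by
    intro u v huv huvI
    obtain ⟨f, hf1, hf⟩ := exists_C0_far_of_interval hp hI huv huvI Complex.continuous_ofReal
      (Or.inl Complex.ofReal_im) Complex.ofReal_injective.injOn 0
    have h1 := hf 0 (zero_mem_ratFunctions _ _)
    rw [sub_zero, eLpNorm_congr_ae (hX.coe_inclusion f).symm] at h1
    have hpos : 0 < (v - u) / 6 := by linarith
    have h2 := (ENNReal.ofReal_le_ofReal_iff'.1 (h1.trans (hC' _))).resolve_right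
      (not_le.2 (by positivity))
    have h3 : ((v - u) / 6) ^ (1 / p) ≤ 2 * (C' * C) := by
      have h4 : C' * N (hX.inclusion f) ≤ C' * (C * 1) := by
        gcongr
        exact (hC f).trans (by gcongr)
      linarith
    have h5 := Real.rpow_le_rpow (by positivity) h3 hp.le
    rw [← Real.rpow_mul hpos.le, one_div_mul_cancel hp.ne', Real.rpow_one] at h5
    linarith
  set R := 6 * (2 * (C' * C)) ^ p with hR
  obtain ⟨u, v, huv, -, huvI⟩ := exists_Icc_subset_of_interior hne
  have hu := huvI (Set.left_mem_Icc.2 huv.le)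
  have hR0 : 0 ≤ R := by linarith [key u v huv huvI]
  refine ⟨⟨u - R, fun t ht => ?_⟩, ⟨u + R, fun t ht => ?_⟩⟩
  · rcases lt_or_ge t u with h | h
    · linarith [key t u h (hI.out ht hu)]
    · linarith
  · rcases lt_or_ge u t with h | h
    · linarith [key u t h (hI.out hu ht)]
    · linarith

theorem countable_exp_I_mul_eq (ζ : ℂ) :
    {t : ℝ | Complex.exp (Complex.I * (t : ℂ)) = ζ}.Countable := by
  rcases Set.eq_empty_or_nonempty {t : ℝ | Complex.exp (Complex.I * (t : ℂ)) = ζ} with h | ⟨s, hs⟩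
  · rw [h]; exact Set.countable_empty
  · refine (Set.countable_range fun n : ℤ => s + n * (2 * Real.pi)).mono fun t ht => ?_
    have hts : Complex.exp (Complex.I * (t : ℂ)) = Complex.exp (Complex.I * (s : ℂ)) :=
      ht.trans hs.symm
    obtain ⟨n, hn⟩ := Complex.exp_eq_exp_iff_exists_int.1 hts
    refine ⟨n, ?_⟩
    have h1 : (t : ℂ) = s + n * (2 * Real.pi) := by
      apply mul_left_cancel₀ Complex.I_ne_zero
      rw [hn]; ring
    exact_mod_cast h1.symm

/-- The approximation scheme on a bounded interval with end points `c` and `d`. The numerator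
of the functions with a pole of maximal order has to vanish at the end points outside `I`, which is
possible if the degrees are at least their number. -/
theorem IsBetweenC0AndLp.isApproximationScheme_interval {I : Set ℝ} {c d : ℝ} (hcd : c < d)
    (hI₁ : Set.Ioo c d ⊆ I) (hI₂ : I ⊆ Set.Icc c d) (hI : I.OrdConnected)
    {X : Submodule ℂ (I →ₘ[lebesgueOn I] ℂ)} {N : X → ℝ}
    (hX : IsBetweenC0AndLp (lebesgueOn I) p X N) (hp : 0 < p) {z : ℝ → ℂ} (hz : Continuous z)
    (hnull : ∀ ζ, {t : ℝ | z t = ζ}.Countable) {w : ℂ} (hw : ∀ t, z t ≠ w) {D : ℕ → ℕ}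
    (hD : StrictMono D) (hDK : ∃ K : ℕ → ℕ, ∀ n, n ≤ K n ∧ 2 * D n ≤ D (K n))
    (hdeg : ∀ n, 2 ≤ D (n + 1) ∨ (c ∈ I ∨ d ∈ I) ∧ 1 ≤ D (n + 1))
    (hdense : ∀ x : X, ∀ ε > 0, ∃ (f : C₀(I, ℂ)) (y : X),
      (y : I →ₘ[lebesgueOn I] ℂ) =ᵐ[lebesgueOn I] f ∧
      N (x - y) < ε ∧ ∀ δ > 0, ∃ g : C₀(I, ℂ), ‖f - g‖ ≤ δ ∧
        ∃ n, ⇑g ∈ ratFunctions (fun t : I => z t) n) :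
    IsApproximationScheme N (fun n => elementsIn X (ratFunctions (fun t : I => z t) (D n))) := by
  classical
  refine hX.isApproximationScheme hp ?_ ?_ hD hDK (w := w) (fun t => hw t) (fun n => ?_) hdense
  · intro h0
    have h1 := lebesgueOn_preimage hI _ hI₁
    rw [h0, Measure.coe_zero, Pi.zero_apply, Real.volume_Ioo] at h1
    exact absurd h1.symm (by simpa using hcd)
  · intro ζ
    rw [lebesgueOn, comap_subtype_coe_apply hI.measurableSet]
    refine Set.Countable.measure_zero ((hnull ζ).mono ?_) _
    rintro _ ⟨t, ht, rfl⟩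
    exact ht
  · let r : ℂ[X] := (if c ∈ I then 1 else Polynomial.X - C (z c)) *
      (if d ∈ I then 1 else Polynomial.X - C (z d))
    have hr : r = (if c ∈ I then 1 else Polynomial.X - C (z c)) *
      (if d ∈ I then 1 else Polynomial.X - C (z d)) := rfl
    refine ⟨r, ?_, ?_, ?_⟩
    · have h1 : ∀ (a : ℝ), (if a ∈ I then 1 else Polynomial.X - C (z a) : ℂ[X]).natDegree
          = if a ∈ I then 0 else 1 := by
        intro a; split_ifs <;> simp
      refine natDegree_mul_le.trans ?_
      rw [h1, h1]
      rcases hdeg n with h | ⟨h | h, h'⟩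
      · split_ifs <;> omega
      · rw [if_pos h]; split_ifs <;> omega
      · rw [if_pos h]; split_ifs <;> omega
    · rw [hr, eval_mul]
      refine mul_ne_zero ?_ ?_
      · split_ifs
        · simp
        · simpa using sub_ne_zero.2 (hw c).symm
      · split_ifs
        · simp
        · simpa using sub_ne_zero.2 (hw d).symm
    · refine exists_C0_eq_of_endpoints (g := fun t => r.eval (z t) / (z t - w) ^ D (n + 1))
        hI₁ hI₂ (Continuous.continuousOn ?_) (fun hc => ?_) (fun hd => ?_)
      · exact (r.continuous.comp hz).div ((hz.sub continuous_const).pow _)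
          fun t => pow_ne_zero _ (sub_ne_zero.2 (hw t))
      · rw [hr, eval_mul, if_neg hc]; simp
      · rw [hr, eval_mul, if_neg hd]; simp

theorem exists_C0_near_realCoord {I : Set ℝ} {c d : ℝ} (hcd : c < d) (hI₁ : Set.Ioo c d ⊆ I)
    (hI₂ : I ⊆ Set.Icc c d) (f : C₀(I, ℂ)) {δ : ℝ} (hδ : 0 < δ) :
    ∃ g : C₀(I, ℂ), ‖f - g‖ ≤ δ ∧ ∃ n, ⇑g ∈ ratFunctions (realCoord I) n := by
  obtain ⟨g, hfg, P, ⟨Q, hQ⟩, hg⟩ := exists_C0_near_of_approx hcd hI₁ hI₂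
    (z := fun t : ℝ => (t : ℂ)) Complex.continuous_ofReal
    (W := {P | ∃ Q : ℂ[X], ∀ t : ℝ, P t = Q.eval (t : ℂ)})
    (by
      rintro P ⟨Q, hQ⟩
      rw [show P = fun t : ℝ => Q.eval (t : ℂ) from funext hQ]
      exact Q.continuous.comp Complex.continuous_ofReal)
    (by
      rintro P ⟨Q, hQ⟩ α β
      exact ⟨Q - (C α + C β * Polynomial.X), fun t => by simp [hQ]⟩)
    (fun h => absurd (Complex.ofReal_injective h) hcd.ne) f
    (by
      intro ε hε
      obtain ⟨F, hF, hFf⟩ := exists_continuous_near_extend hcd hI₁ f (half_pos hε)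
      obtain ⟨Q, hQ⟩ := exists_polynomial_near_complex (c := c) (d := d) hF (half_pos hε)
      refine ⟨fun t => Q.eval (t : ℂ), ⟨Q, fun t => rfl⟩, fun t ht => ?_⟩
      rw [← sub_add_sub_cancel _ (F t)]
      exact (norm_add_le _ _).trans (by linarith [hQ t ht, hFf t ht])) hδ
  refine ⟨g, hfg, Q.natDegree, Q, 1, le_rfl, by simp, by simp, fun t => ?_⟩
  rw [hg, hQ, eval_one, div_one]
  rfl

theorem exists_C0_near_realExp {I : Set ℝ} {a c d : ℝ} (hcd : c < d) (hI₁ : Set.Ioo c d ⊆ I)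
    (hI₂ : I ⊆ Set.Icc c d) (hac : a ≤ c) (hda : d ≤ a + 2 * Real.pi) (f : C₀(I, ℂ))
    (hf : Function.extend Subtype.val f 0 a = Function.extend Subtype.val f 0 (a + 2 * Real.pi))
    {δ : ℝ} (hδ : 0 < δ) :
    ∃ g : C₀(I, ℂ), ‖f - g‖ ≤ δ ∧ ∃ n, ⇑g ∈ ratFunctions (realExp I) n := by
  have hexp : ∀ t : ℝ, Complex.exp (Complex.I * (t : ℂ)) ≠ 0 := fun t => Complex.exp_ne_zero _
  obtain ⟨g, hfg, P, ⟨Q, m, hQ⟩, hg⟩ := exists_C0_near_of_approx hcd hI₁ hI₂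
    continuous_exp_I_mul
    (W := {P | ∃ (Q : ℂ[X]) (m : ℕ), ∀ t : ℝ, P t = Q.eval (Complex.exp (Complex.I * (t : ℂ))) /
      Complex.exp (Complex.I * (t : ℂ)) ^ m})
    (by
      rintro P ⟨Q, m, hQ⟩
      rw [show P = _ from funext hQ]
      exact (Q.continuous.comp continuous_exp_I_mul).div (continuous_exp_I_mul.pow m)
        fun t => pow_ne_zero _ (hexp t))
    (by
      rintro P ⟨Q, m, hQ⟩ α β
      refine ⟨Q - (C α + C β * Polynomial.X) * Polynomial.X ^ m, m, fun t => ?_⟩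
      have := hexp t
      simp only [hQ, eval_sub, eval_mul, eval_add, eval_C, eval_X, eval_pow]
      field_simp)
    (by
      rintro h P ⟨Q, m, hQ⟩
      rw [hQ, hQ, h]) f
    (by
      intro ε hε
      obtain ⟨F, hF, hFf⟩ := exists_continuous_near_extend hcd hI₁ f
        (show 0 < ε / 4 by positivity)
      obtain ⟨F', hF', hFa, hFF'⟩ := exists_periodic_near hac hcd hda hF
        (show 0 ≤ ε / 2 by positivity) (by
          intro hca hdb
          have h1 := hFf c (Set.left_mem_Icc.2 hcd.le)
          have h2 := hFf d (Set.right_mem_Icc.2 hcd.le)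
          rw [← hdb, ← hca] at hf
          rw [← hf] at h2
          rw [← sub_sub_sub_cancel_right _ _ (Function.extend Subtype.val (⇑f) 0 c)]
          exact (norm_sub_le _ _).trans (by linarith))
      obtain ⟨Q, m, hQ⟩ := exists_laurent_near_of_periodic hF' hFa
        (show 0 < ε / 4 by positivity)
      refine ⟨fun t => _, ⟨Q, m, fun t => rfl⟩, fun t ht => ?_⟩
      have h1 := hQ t ⟨hac.trans ht.1, ht.2.trans hda⟩
      rw [← sub_add_sub_cancel _ (F' t), ← sub_add_sub_cancel (F' t) (F t)]
      refine (norm_add_le _ _).trans ?_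
      have h2 := norm_add_le (F' t - F t) (F t - Function.extend Subtype.val (⇑f) 0 t)
      linarith [hFF' t ht, hFf t ht]) hδ
  refine ⟨g, hfg, max Q.natDegree m, ?_⟩
  have heq : ⇑g = fun t : I => Q.eval (realExp I t) / realExp I t ^ m :=
    funext fun t => (hg t).trans (hQ t)
  rw [heq]
  exact laurent_mem_ratFunctions (z := realExp I) (fun t => hexp t) Q m

/-- The approximation scheme and Shapiro's Theorem for a compact space with a coordinate `z` on the
unit circle that is parametrized by `[0, 2π]`. -/
theorem IsBetweenC0AndLp.scheme_and_shapiro_of_circle {Ω : Type*} [TopologicalSpace Ω]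
    [CompactSpace Ω] [MeasurableSpace Ω] [BorelSpace Ω] {μ : Measure Ω} {z : Ω → ℂ}
    (hz : Continuous z) {τ : ℝ → Ω} (hτ : Continuous τ)
    (hτμ : Measure.map τ (volume.restrict (Set.Ioc 0 (2 * Real.pi))) = μ)
    (hzτ : ∀ t, z (τ t) = Complex.exp (Complex.I * (t : ℂ))) (hz1 : ∀ x, ‖z x‖ = 1)
    {σ : AddCircle (2 * Real.pi) → Ω} (hσ : Continuous σ) (hσs : Function.Surjective σ)
    (hzσ : ∀ x, z (σ x) = torusExp x) {X : Submodule ℂ (Ω →ₘ[μ] ℂ)} {N : X → ℝ}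
    (hX : IsBetweenC0AndLp μ p X N) (hp : 0 < p) {k : ℕ} (hk : 0 < k) :
    IsApproximationScheme N (fun n => elementsIn X (ratFunctions z (k * n))) ∧
      SatisfiesShapiro N (fun n => elementsIn X (ratFunctions z (k * n))) := by
  have hpi := Real.two_pi_pos
  have hz0 : ∀ x, z x ≠ 0 := fun x h => by simpa [h] using hz1 x
  have hz2 : ∀ x, z x ≠ 2 := fun x h => by simpa [h] using hz1 x
  refine ⟨hX.isApproximationScheme hp ?_ (fun ζ => ?_)
    (fun m n hmn => Nat.mul_lt_mul_of_pos_left hmn hk)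
    ⟨fun n => 2 * n, fun n => ⟨Nat.le_mul_of_pos_left n two_pos, (mul_left_comm 2 k n).le⟩⟩
    hz2 (fun n => ?_) (fun x ε hε => ?_),
    hX.satisfiesShapiro hp ⟨_, by positivity,
      exists_C0_far_of_circle hp hz hτ hτμ hzτ hz1⟩ k⟩
  · intro h0
    have h1 : μ Set.univ = ENNReal.ofReal (2 * Real.pi) := by
      rw [← hτμ, Measure.map_apply hτ.measurable MeasurableSet.univ, Set.preimage_univ,
        Measure.restrict_apply_univ, Real.volume_Ioc, sub_zero]
    rw [h0, Measure.coe_zero, Pi.zero_apply] at h1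
    exact absurd h1.symm (by simpa using Real.pi_pos)
  · rw [← hτμ, Measure.map_apply hτ.measurable
      (isClosed_singleton.preimage hz).measurableSet]
    refine Set.Countable.measure_zero ((countable_exp_I_mul_eq ζ).mono fun t ht => ?_) _
    rw [Set.mem_ofPred_eq, ← hzτ]
    exact ht
  · refine ⟨1, by simp, by simp, ⟨⟨fun x => (1 : ℂ[X]).eval (z x) / (z x - 2) ^ (k * (n + 1)), ?_⟩,
      by simp⟩, fun t => rfl⟩
    exact ((1 : ℂ[X]).continuous.comp hz).div ((hz.sub continuous_const).pow _)
      fun t => pow_ne_zero _ (sub_ne_zero.2 (hz2 t))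
  · obtain ⟨f, y, hy, hxy⟩ := hX.C0_dense x ε hε
    refine ⟨f, y, hy, hxy, fun δ hδ => ?_⟩
    obtain ⟨Q, m, hQ⟩ := exists_laurent_near ⟨fun x => f (σ x), f.continuous.comp hσ⟩ hδ
    have hc : Continuous fun x => Q.eval (z x) / z x ^ m :=
      (Q.continuous.comp hz).div (hz.pow m) fun x => pow_ne_zero _ (hz0 x)
    refine ⟨⟨⟨fun x => Q.eval (z x) / z x ^ m, hc⟩, by simp⟩, norm_C0_le hδ.le fun x => ?_,
      _, laurent_mem_ratFunctions hz0 Q m⟩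
    obtain ⟨s, rfl⟩ := hσs x
    have h1 := hQ s
    rw [← hzσ, norm_sub_rev] at h1
    exact h1

theorem map_coe_addCircle : Measure.map ((↑) : ℝ → AddCircle (2 * Real.pi))
    (volume.restrict (Set.Ioc 0 (2 * Real.pi))) = volume := by
  have h := (AddCircle.measurePreserving_mk (2 * Real.pi) 0).map_eq
  rwa [zero_add] at h

theorem continuous_torusToCircle : Continuous torusToCircle :=
  Continuous.subtype_mk continuous_torusExp _

theorem surjective_torusToCircle : Function.Surjective torusToCircle := by
  rintro ⟨w, hw⟩
  obtain ⟨x, hx⟩ := (AddCircle.homeomorphCircle Real.two_pi_pos.ne').surjective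
    ⟨w, by simpa [Submonoid.unitSphere] using hw⟩
  refine ⟨x, Subtype.ext ?_⟩
  have := congrArg Subtype.val hx
  rw [AddCircle.homeomorphCircle_apply] at this
  exact this

end Assembly

/-! ### Spaces between the disk algebra and `H_p` -/

section Disk

/-- The closed unit disk. -/
abbrev ClosedDisk : Set ℂ := Metric.closedBall (0 : ℂ) 1

theorem extend_closedDisk_apply (g : ClosedDisk → ℂ) {w : ℂ} (hw : w ∈ ClosedDisk) :
    Function.extend Subtype.val g 0 w = g ⟨w, hw⟩ :=
  Subtype.val_injective.extend_apply g 0 ⟨w, hw⟩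

theorem extend_openDisk_apply (g : OpenDisk → ℂ) {w : ℂ} (hw : w ∈ OpenDisk) :
    Function.extend Subtype.val g 0 w = g ⟨w, hw⟩ :=
  Subtype.val_injective.extend_apply g 0 ⟨w, hw⟩

/-- The disk algebra as a space of continuous functions on the closed disk, with the supremum
norm. -/
def closedDiskAlgebra : Submodule ℂ C(ClosedDisk, ℂ) where
  carrier := {g | DifferentiableOn ℂ (Function.extend Subtype.val g 0) OpenDisk}
  zero_mem' := by
    refine (differentiableOn_const 0).congr fun w hw => ?_
    rw [extend_closedDisk_apply _ (Metric.ball_subset_closedBall hw)]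
    rfl
  add_mem' {f g} hf hg := by
    refine (DifferentiableOn.add hf hg).congr fun w hw => ?_
    have hw' := Metric.ball_subset_closedBall hw
    rw [Pi.add_apply, extend_closedDisk_apply _ hw', extend_closedDisk_apply _ hw',
      extend_closedDisk_apply _ hw']
    rfl
  smul_mem' a f hf := by
    refine (DifferentiableOn.const_smul hf a).congr fun w hw => ?_
    have hw' := Metric.ball_subset_closedBall hw
    rw [Pi.smul_apply, extend_closedDisk_apply _ hw', extend_closedDisk_apply _ hw']
    rfl

theorem isClosed_closedDiskAlgebra : IsClosed (closedDiskAlgebra : Set C(ClosedDisk, ℂ)) := by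
  refine IsSeqClosed.isClosed fun u g hu hug => ?_
  have h1 : TendstoUniformlyOn (fun n => Function.extend Subtype.val (u n) 0)
      (Function.extend Subtype.val g 0) atTop OpenDisk := by
    rw [Metric.tendstoUniformlyOn_iff]
    intro ε hε
    filter_upwards [Metric.tendsto_nhds.1 hug ε hε] with n hn w hw
    have hw' := Metric.ball_subset_closedBall hw
    rw [extend_closedDisk_apply _ hw', extend_closedDisk_apply _ hw', dist_comm]
    exact (ContinuousMap.dist_apply_le_dist _).trans_lt hn
  exact h1.tendstoLocallyUniformlyOn.differentiableOn (Eventually.of_forall hu) Metric.isOpen_ball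

instance completeSpace_closedDiskAlgebra : CompleteSpace closedDiskAlgebra :=
  isClosed_closedDiskAlgebra.completeSpace_coe

theorem continuousOn_extend_closedDisk (g : C(ClosedDisk, ℂ)) :
    ContinuousOn (Function.extend Subtype.val g 0) ClosedDisk := by
  rw [continuousOn_iff_continuous_domRestrict]
  exact g.continuous.congr fun w => (extend_closedDisk_apply g w.2).symm

/-- The element of the disk algebra given by a function on the plane. -/
def closedDiskAlgebra.ofDiffContOnCl (F : ℂ → ℂ) (hF : DiffContOnCl ℂ F OpenDisk) :
    closedDiskAlgebra :=
  ⟨⟨fun w => F w, hF.continuousOn_ball.domRestrict⟩, hF.differentiableOn.congr fun w hw => by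
    rw [extend_closedDisk_apply _ (Metric.ball_subset_closedBall hw)]
    rfl⟩

theorem closedDiskAlgebra.ofDiffContOnCl_apply (F : ℂ → ℂ) (hF : DiffContOnCl ℂ F OpenDisk)
    (w : ClosedDisk) : (ofDiffContOnCl F hF).1 w = F w := rfl

theorem closedDiskAlgebra.norm_le {g : closedDiskAlgebra} {c : ℝ} (hc : 0 ≤ c)
    (h : ∀ w : ClosedDisk, ‖g.1 w‖ ≤ c) : ‖g‖ ≤ c :=
  (ContinuousMap.norm_le _ hc).2 h

/-- The restriction of a function on the closed disk to the open disk. -/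
def restrictOpenDisk (g : ClosedDisk → ℂ) (w : OpenDisk) : ℂ :=
  g ⟨w, Metric.ball_subset_closedBall w.2⟩

theorem closedDiskAlgebra.restrict_mem (g : closedDiskAlgebra) :
    restrictOpenDisk g.1 ∈ diskAlgebra := by
  refine ⟨Function.extend Subtype.val g.1 0, ⟨g.2, ?_⟩, fun w =>
    (extend_closedDisk_apply _ (Metric.ball_subset_closedBall w.2)).symm⟩
  rw [closure_ball _ one_ne_zero]
  exact continuousOn_extend_closedDisk g.1

variable {p : ℝ} {X : Submodule ℂ (OpenDisk → ℂ)} {N : X → ℝ}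

/-- The inclusion of the disk algebra into `X`. -/
def IsBetweenDiskAlgebraAndHp.inclusion (hX : IsBetweenDiskAlgebraAndHp p X N) :
    closedDiskAlgebra →ₗ[ℂ] X where
  toFun g := ⟨restrictOpenDisk g.1, hX.diskAlgebra_subset _ (closedDiskAlgebra.restrict_mem g)⟩
  map_add' _ _ := rfl
  map_smul' _ _ := rfl

theorem IsBetweenDiskAlgebraAndHp.inclusion_apply (hX : IsBetweenDiskAlgebraAndHp p X N)
    (g : closedDiskAlgebra) (w : OpenDisk) :
    (hX.inclusion g : OpenDisk → ℂ) w = g.1 ⟨w, Metric.ball_subset_closedBall w.2⟩ := rfl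

theorem circleMap_mem_openDisk {r : ℝ} (hr : r ∈ Set.Ico (0 : ℝ) 1) (θ : ℝ) :
    circleMap 0 r θ ∈ OpenDisk := by
  rw [mem_ball_zero_iff, norm_circleMap_zero, abs_of_nonneg hr.1]
  exact hr.2

/-- The Hardy norm dominates the `L_p` norms on the circles in the disk. -/
theorem eLpNorm_circle_le_hardyNorm (hp : 0 < p) (f : OpenDisk → ℂ) {r : ℝ}
    (hr : r ∈ Set.Ico (0 : ℝ) 1) :
    eLpNorm (fun θ => Function.extend Subtype.val f 0 (circleMap 0 r θ)) (ENNReal.ofReal p)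
      (volume.restrict (Set.Ioc 0 (2 * Real.pi))) ≤
      ENNReal.ofReal ((2 * Real.pi) ^ (1 / p)) * hardyNorm p f := by
  have hpi := Real.two_pi_pos
  have hp' : 0 ≤ 1 / p := by positivity
  rw [eLpNorm_eq_lintegral_rpow_enorm_toReal (by simpa using hp) ENNReal.ofReal_ne_top,
    ENNReal.toReal_ofReal hp.le, ← ENNReal.ofReal_rpow_of_pos hpi]
  set J := ∫⁻ θ in Set.Ioc 0 (2 * Real.pi),
    ‖Function.extend Subtype.val f 0 (circleMap 0 r θ)‖ₑ ^ p with hJ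
  have h1 : J = ENNReal.ofReal (2 * Real.pi) * (ENNReal.ofReal (2 * Real.pi)⁻¹ * J) := by
    rw [← mul_assoc, ← ENNReal.ofReal_mul hpi.le, mul_inv_cancel₀ hpi.ne', ENNReal.ofReal_one,
      one_mul]
  rw [h1, ENNReal.mul_rpow_of_nonneg _ _ hp']
  gcongr
  exact le_iSup₂_of_le (f := fun r (_ : r ∈ Set.Ico (0 : ℝ) 1) =>
    (ENNReal.ofReal (2 * Real.pi)⁻¹ * ∫⁻ θ in Set.Ioc 0 (2 * Real.pi),
      ‖Function.extend Subtype.val f 0 (circleMap 0 r θ)‖ₑ ^ p) ^ (1 / p)) r hr le_rfl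

theorem IsHolomorphicOnDisk.continuous_circle {f : OpenDisk → ℂ} (hf : IsHolomorphicOnDisk f)
    {r : ℝ} (hr : r ∈ Set.Ico (0 : ℝ) 1) :
    Continuous fun θ => Function.extend Subtype.val f 0 (circleMap 0 r θ) :=
  hf.continuousOn.comp_continuous (continuous_circleMap 0 r) (circleMap_mem_openDisk hr)

theorem exists_circleMap_eq (w : ℂ) :
    ∃ θ ∈ Set.Ioc 0 (2 * Real.pi), circleMap 0 ‖w‖ θ = w := by
  have hpi := Real.pi_pos
  have hw : circleMap 0 ‖w‖ w.arg = w := by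
    rw [circleMap_zero]; exact Complex.norm_mul_exp_arg_mul_I w
  rcases lt_or_ge 0 w.arg with h | h
  · exact ⟨w.arg, ⟨h, by linarith [Complex.arg_le_pi w]⟩, hw⟩
  · refine ⟨w.arg + 2 * Real.pi, ⟨by linarith [Complex.neg_pi_lt_arg w], by linarith⟩, ?_⟩
    rw [periodic_circleMap 0 ‖w‖, hw]

theorem IsBetweenDiskAlgebraAndHp.exists_one_le (hX : IsBetweenDiskAlgebraAndHp p X N) :
    ∃ C : ℝ, 1 ≤ C ∧ ∀ x : X, hardyNorm p x ≤ ENNReal.ofReal (C * N x) := by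
  obtain ⟨C, hC⟩ := hX.subset_Hp
  refine ⟨max C 1, le_max_right _ _, fun x => (hC x).trans (ENNReal.ofReal_le_ofReal ?_)⟩
  exact mul_le_mul_of_nonneg_right (le_max_left _ _) (hX.quasiBanach.nonneg x)

/-- The closed graph theorem applies to the inclusion of the disk algebra: convergence in `H_p`
determines the values of the limit on each circle, through almost everywhere convergence of
subsequences. -/
theorem IsBetweenDiskAlgebraAndHp.exists_bound (hX : IsBetweenDiskAlgebraAndHp p X N)
    (hp : 0 < p) : ∃ C > 0, ∀ g, N (hX.inclusion g) ≤ C * ‖g‖ := by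
  refine exists_bound_of_closed_graph hX.quasiBanach hX.inclusion fun u b x hu hx => ?_
  obtain ⟨C, -, hC⟩ := hX.exists_one_le
  have hcirc : ∀ r ∈ Set.Ico (0 : ℝ) 1, Set.EqOn
      (fun θ => Function.extend Subtype.val (hX.inclusion b : OpenDisk → ℂ) 0 (circleMap 0 r θ))
      (fun θ => Function.extend Subtype.val (x : OpenDisk → ℂ) 0 (circleMap 0 r θ))
      (Set.Ioc 0 (2 * Real.pi)) := by
    intro r hr
    have hcont := fun y : X => (hX.holomorphic y).continuous_circle hr
    have h0 : Tendsto (fun n => eLpNorm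
        ((fun θ => Function.extend Subtype.val (hX.inclusion (u n) : OpenDisk → ℂ) 0
          (circleMap 0 r θ)) -
          fun θ => Function.extend Subtype.val (x : OpenDisk → ℂ) 0 (circleMap 0 r θ))
        (ENNReal.ofReal p) (volume.restrict (Set.Ioc 0 (2 * Real.pi)))) atTop (𝓝 0) := by
      refine tendsto_of_tendsto_of_tendsto_of_le_of_le (h := fun n =>
        ENNReal.ofReal ((2 * Real.pi) ^ (1 / p)) * ENNReal.ofReal (C * N (hX.inclusion (u n) - x)))
        tendsto_const_nhds ?_ (fun n => zero_le) fun n => ?_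
      · have h1 := ENNReal.Tendsto.const_mul (ENNReal.tendsto_ofReal (hx.const_mul C))
          (Or.inr (ENNReal.ofReal_ne_top (r := (2 * Real.pi) ^ (1 / p))))
        simpa using h1
      · have h1 := eLpNorm_circle_le_hardyNorm hp
          ((hX.inclusion (u n) - x : X) : OpenDisk → ℂ) hr
        have h2 : (fun θ => Function.extend Subtype.val
            ((hX.inclusion (u n) - x : X) : OpenDisk → ℂ) 0 (circleMap 0 r θ))
            = (fun θ => Function.extend Subtype.val (hX.inclusion (u n) : OpenDisk → ℂ) 0
              (circleMap 0 r θ)) -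
              fun θ => Function.extend Subtype.val (x : OpenDisk → ℂ) 0 (circleMap 0 r θ) := by
          funext θ
          have hθ := circleMap_mem_openDisk hr θ
          rw [Pi.sub_apply, extend_openDisk_apply _ hθ, extend_openDisk_apply _ hθ,
            extend_openDisk_apply _ hθ]
          rfl
        rw [h2] at h1
        exact h1.trans (mul_le_mul' le_rfl (hC _))
    obtain ⟨φ, hφ, hae⟩ := (tendstoInMeasure_of_tendsto_eLpNorm (by simpa using hp)
      (fun n => (hcont _).aestronglyMeasurable) (hcont x).aestronglyMeasurable
      h0).exists_seq_tendsto_ae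
    refine Measure.eqOn_Ioc_of_ae_eq (μ := volume) ?_ (hcont _).continuousOn (hcont x).continuousOn
    filter_upwards [hae] with θ h1
    refine tendsto_nhds_unique ?_ h1
    have hθ := circleMap_mem_openDisk hr θ
    have h3 : Tendsto (fun n => (u n).1 ⟨circleMap 0 r θ, Metric.ball_subset_closedBall hθ⟩) atTop
        (𝓝 (b.1 ⟨circleMap 0 r θ, Metric.ball_subset_closedBall hθ⟩)) :=
      (ContinuousMap.tendsto_iff_tendstoUniformly.1
        ((continuous_subtype_val.tendsto b).comp hu)).tendsto_at _
    simp only [extend_openDisk_apply _ hθ, hX.inclusion_apply]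
    exact h3.comp hφ.tendsto_atTop
  refine Subtype.ext (funext fun w => ?_)
  obtain ⟨θ, hθ, hw⟩ := exists_circleMap_eq (w : ℂ)
  have hr : ‖(w : ℂ)‖ ∈ Set.Ico (0 : ℝ) 1 := ⟨norm_nonneg _, mem_ball_zero_iff.1 w.2⟩
  have h1 := hcirc _ hr hθ
  simp only [hw] at h1
  rwa [extend_openDisk_apply _ w.2, extend_openDisk_apply _ w.2] at h1

/-- A function that is continuous on the closed disk is uniformly close to its dilations. -/
theorem exists_dilation_near {F : ℂ → ℂ} (hF : ContinuousOn F ClosedDisk) {η : ℝ} (hη : 0 < η) :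
    ∃ ρ ∈ Set.Ioo (0 : ℝ) 1, ∀ w ∈ ClosedDisk, ‖F (ρ * w) - F w‖ ≤ η := by
  have hu := (isCompact_closedBall (0 : ℂ) 1).uniformContinuousOn_of_continuous hF
  obtain ⟨δ, hδ, hu⟩ := Metric.uniformContinuousOn_iff.1 hu η hη
  have h1 : 0 < min δ 1 := lt_min hδ one_pos
  have h2 := min_le_left δ 1
  have h3 := min_le_right δ 1
  refine ⟨1 - min δ 1 / 2, ⟨by linarith, by linarith⟩, fun w hw => ?_⟩
  have hw1 : ‖w‖ ≤ 1 := mem_closedBall_zero_iff.1 hw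
  rw [← dist_eq_norm]
  refine (hu _ ?_ w hw ?_).le
  · rw [mem_closedBall_zero_iff, norm_mul, Complex.norm_real, Real.norm_of_nonneg (by linarith)]
    exact mul_le_one₀ (by linarith) (norm_nonneg _) hw1
  · rw [dist_eq_norm, show ((1 - min δ 1 / 2 : ℝ) : ℂ) * w - w = ((-(min δ 1 / 2) : ℝ) : ℂ) * w by
      push_cast; ring, norm_mul, Complex.norm_real, norm_neg, Real.norm_of_nonneg (by positivity)]
    nlinarith [norm_nonneg w]

/-- Polynomials are dense in the disk algebra: dilate, and truncate the Taylor series. -/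
theorem closedDiskAlgebra.exists_polynomial_near (g : closedDiskAlgebra) {η : ℝ} (hη : 0 < η) :
    ∃ Q : ℂ[X], ∀ w : ClosedDisk, ‖g.1 w - Q.eval (w : ℂ)‖ ≤ η := by
  set F := Function.extend Subtype.val g.1 0 with hF
  obtain ⟨ρ, hρ, hρF⟩ := exists_dilation_near (continuousOn_extend_closedDisk g.1) (half_pos hη)
  have hd : DifferentiableOn ℂ F OpenDisk := g.2
  obtain ⟨ρ₁, h1, h2⟩ := exists_between hρ.2
  obtain ⟨ρ₂, h3, h4⟩ := exists_between h2
  have hρ0 := hρ.1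
  lift ρ₁ to NNReal using by linarith
  lift ρ₂ to NNReal using by linarith
  have hps := DifferentiableOn.hasFPowerSeriesOnBall (R := ρ₂) (c := 0)
    (hd.mono (Metric.closedBall_subset_ball h4)) (by exact_mod_cast hρ0.trans (h1.trans h3))
  have hunif := hps.tendstoUniformlyOn (r' := ρ₁) (by exact_mod_cast h3)
  obtain ⟨n, hn⟩ := (Metric.tendstoUniformlyOn_iff.1 hunif (η / 2) (half_pos hη)).exists
  refine ⟨∑ k ∈ Finset.range n, C ((cauchyPowerSeries F 0 ρ₂).coeff k * (ρ : ℂ) ^ k) *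
    Polynomial.X ^ k, fun w => ?_⟩
  have hw1 : ‖(w : ℂ)‖ ≤ 1 := mem_closedBall_zero_iff.1 w.2
  have hmem : (ρ : ℂ) * w ∈ Metric.ball (0 : ℂ) ρ₁ := by
    rw [mem_ball_zero_iff, norm_mul, Complex.norm_real, Real.norm_of_nonneg hρ0.le]
    nlinarith
  have h5 := (hn _ hmem).le
  rw [zero_add, dist_eq_norm] at h5
  have h6 : (∑ k ∈ Finset.range n, C ((cauchyPowerSeries F 0 ρ₂).coeff k * (ρ : ℂ) ^ k) *
      Polynomial.X ^ k).eval (w : ℂ)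
      = (cauchyPowerSeries F 0 ρ₂).partialSum n ((ρ : ℂ) * w) := by
    rw [FormalMultilinearSeries.partialSum, eval_finsetSum]
    refine Finset.sum_congr rfl fun k _ => ?_
    rw [FormalMultilinearSeries.apply_eq_pow_smul_coeff, eval_mul, eval_C, eval_pow, eval_X,
      smul_eq_mul, mul_pow]
    ring
  rw [h6, ← extend_closedDisk_apply g.1 w.2, ← sub_add_sub_cancel _ (F (ρ * w))]
  refine (norm_add_le _ _).trans ?_
  have h7 := hρF w w.2
  rw [norm_sub_rev] at h7
  linarith

theorem diffContOnCl_rational {P Q : ℂ[X]} (hQ : ∀ w ∈ ClosedDisk, Q.eval w ≠ 0) :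
    DiffContOnCl ℂ (fun w => P.eval w / Q.eval w) OpenDisk := by
  refine DifferentiableOn.diffContOnCl ?_
  rw [closure_ball _ one_ne_zero]
  exact P.differentiable.differentiableOn.div Q.differentiable.differentiableOn hQ

/-- In the Hardy space, the monomial `- i w ^ (4 n + 1)` is far from rational functions of
degree `n` with poles off the closed disk. -/
theorem le_hardyNorm_of_monomial (hp : 0 < p) {n : ℕ} {g : ClosedDisk → ℂ}
    (hg : g ∈ ratFunctions (Subtype.val : ClosedDisk → ℂ) n) {f : OpenDisk → ℂ}
    (hf : ∀ w : OpenDisk, f w = -Complex.I * (w : ℂ) ^ (4 * n + 1) -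
      g ⟨w, Metric.ball_subset_closedBall w.2⟩) :
    ENNReal.ofReal (1 / 4 * (2 * Real.pi / 6) ^ (1 / p)) ≤
      ENNReal.ofReal ((2 * Real.pi) ^ (1 / p)) * hardyNorm p f := by
  obtain ⟨P, Q, hP, hQ, hQ0, hg⟩ := hg
  set G : ℂ → ℂ := fun w => -Complex.I * w ^ (4 * n + 1) - P.eval w / Q.eval w with hG
  have hGc : ContinuousOn G ClosedDisk := by
    refine ContinuousOn.sub (by fun_prop) (ContinuousOn.div P.continuous.continuousOn
      Q.continuous.continuousOn fun w hw => hQ0 ⟨w, hw⟩)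
  have hfG : ∀ w (hw : w ∈ OpenDisk), Function.extend Subtype.val f 0 w = G w := fun w hw => by
    rw [extend_openDisk_apply _ hw, hf, hg]
  obtain ⟨ρ, hρ, hρG⟩ := exists_dilation_near hGc (η := 1 / 4) (by norm_num)
  have hρ' : ρ ∈ Set.Ico (0 : ℝ) 1 := ⟨hρ.1.le, hρ.2⟩
  have hcircle : ∀ t : ℝ, Complex.exp (Complex.I * (t : ℂ)) ∈ ClosedDisk := fun t =>
    mem_closedBall_zero_iff.2 (norm_exp_I_mul t).le
  have hmap : ∀ t : ℝ, circleMap 0 ρ t = ρ * Complex.exp (Complex.I * (t : ℂ)) := fun t => by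
    rw [circleMap_zero, mul_comm Complex.I]
  have hcont : Continuous fun t : ℝ => Function.extend Subtype.val f 0 (circleMap 0 ρ t) := by
    have h1 : Continuous fun t : ℝ => G (circleMap 0 ρ t) :=
      hGc.comp_continuous (continuous_circleMap 0 ρ)
        fun t => Metric.ball_subset_closedBall (circleMap_mem_openDisk hρ' t)
    exact h1.congr fun t => (hfG _ (circleMap_mem_openDisk hρ' t)).symm
  refine le_trans ?_ (eLpNorm_circle_le_hardyNorm hp f hρ')
  refine ofReal_le_eLpNorm_of_le_measure hp hcont.aestronglyMeasurable (by norm_num)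
    (by positivity) ?_
  have hrat : (fun t : ℝ => P.eval (Complex.exp (Complex.I * (t : ℂ))) /
      Q.eval (Complex.exp (Complex.I * (t : ℂ)))) ∈
      ratFunctions (fun t : ℝ => Complex.exp (Complex.I * (t : ℂ))) n :=
    ⟨P, Q, hP, hQ, fun t => hQ0 ⟨_, hcircle t⟩, fun t => rfl⟩
  refine (volume_far_from_monomial
    (continuous_of_mem_ratFunctions continuous_exp_I_mul hrat) hrat).trans ?_
  rw [Measure.restrict_apply (measurableSet_le measurable_const hcont.norm.measurable)]
  refine measure_mono fun t ht => ⟨?_, Set.Ioo_subset_Ioc_self ht.1⟩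
  rw [Set.mem_ofPred_eq, hfG _ (circleMap_mem_openDisk hρ' t), hmap]
  have h1 : 1 / 2 ≤ ‖G (Complex.exp (Complex.I * (t : ℂ)))‖ := ht.2
  have h2 := hρG _ (hcircle t)
  rw [norm_sub_rev] at h2
  have h3 := norm_sub_norm_le (G (Complex.exp (Complex.I * (t : ℂ))))
    (G (ρ * Complex.exp (Complex.I * (t : ℂ))))
  linarith

theorem smul_mem_diskRatElements {n : ℕ} (c : ℂ) {x : X} (hx : x ∈ diskRatElements X n) :
    c • x ∈ diskRatElements X n := by
  obtain ⟨g, hg, hx⟩ := hx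
  refine ⟨c • g, smul_mem_ratFunctions hg c, fun w => ?_⟩
  change c • (x : OpenDisk → ℂ) w = c • _
  rw [hx]

theorem add_mem_diskRatElements {n : ℕ} {x y : X} (hx : x ∈ diskRatElements X n)
    (hy : y ∈ diskRatElements X n) : x + y ∈ diskRatElements X (2 * n) := by
  obtain ⟨g, hg, hx⟩ := hx
  obtain ⟨h, hh, hy⟩ := hy
  refine ⟨g + h, add_mem_ratFunctions hg hh, fun w => ?_⟩
  change (x : OpenDisk → ℂ) w + (y : OpenDisk → ℂ) w = _
  rw [hx, hy]
  rfl

theorem IsBetweenDiskAlgebraAndHp.satisfiesShapiro (hX : IsBetweenDiskAlgebraAndHp p X N)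
    (hp : 0 < p) : SatisfiesShapiro N (diskRatElements X) := by
  have hpi := Real.two_pi_pos
  obtain ⟨C, -, hC⟩ := hX.exists_bound hp
  obtain ⟨C', hC'1, hC'⟩ := hX.exists_one_le
  refine satisfiesShapiro_of_bound hX.quasiBanach.toIsQuasiNorm hX.inclusion hC
    (fun n => ⟨0, zero_mem_ratFunctions _ n, fun w => rfl⟩)
    (fun n c x hx => smul_mem_diskRatElements c hx)
    ⟨fun n => 2 * n, fun n x hx y hy => add_mem_diskRatElements hx hy⟩
    ⟨1 / 4 * (2 * Real.pi / 6) ^ (1 / p) / ((2 * Real.pi) ^ (1 / p) * C'), by positivity,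
      fun n => ?_⟩
  have hd : Differentiable ℂ fun w : ℂ => -Complex.I * w ^ (4 * n + 1) := by fun_prop
  refine ⟨closedDiskAlgebra.ofDiffContOnCl _ hd.diffContOnCl,
    closedDiskAlgebra.norm_le zero_le_one fun w => ?_, fun a ⟨g, hg, ha⟩ => ?_⟩
  · rw [closedDiskAlgebra.ofDiffContOnCl_apply, norm_mul, norm_neg, Complex.norm_I, one_mul,
      norm_pow]
    exact pow_le_one₀ (norm_nonneg _) (mem_closedBall_zero_iff.1 w.2)
  · set b := closedDiskAlgebra.ofDiffContOnCl _ hd.diffContOnCl with hb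
    have h1 := le_hardyNorm_of_monomial hp hg (f := ((hX.inclusion b - a : X) : OpenDisk → ℂ))
      (fun w => by
        change (hX.inclusion b : OpenDisk → ℂ) w - (a : OpenDisk → ℂ) w = _
        rw [ha, hX.inclusion_apply, hb, closedDiskAlgebra.ofDiffContOnCl_apply])
    have h2 : ENNReal.ofReal (1 / 4 * (2 * Real.pi / 6) ^ (1 / p)) ≤
        ENNReal.ofReal ((2 * Real.pi) ^ (1 / p) * (C' * N (hX.inclusion b - a))) := by
      rw [ENNReal.ofReal_mul (p := (2 * Real.pi) ^ (1 / p)) (by positivity)]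
      exact h1.trans (mul_le_mul' le_rfl (hC' _))
    rw [div_le_iff₀' (by positivity), mul_assoc]
    exact (ENNReal.ofReal_le_ofReal_iff'.1 h2).resolve_right (not_le.2 (by positivity))

theorem IsBetweenDiskAlgebraAndHp.isApproximationScheme (hX : IsBetweenDiskAlgebraAndHp p X N)
    (hp : 0 < p) : IsApproximationScheme N (diskRatElements X) where
  strict n := by
    have h2 : ∀ w ∈ ClosedDisk, w ≠ 2 := by
      rintro w hw rfl
      have := mem_closedBall_zero_iff.1 hw
      norm_num at this
    refine ⟨fun x ⟨g, hg, hx⟩ => ⟨g, ratFunctions_mono _ n.le_succ hg, hx⟩, fun hsub => ?_⟩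
    have hpole : ∀ w ∈ ClosedDisk, ((Polynomial.X - C 2) ^ (n + 1) : ℂ[X]).eval w ≠ 0 :=
      fun w hw => by simpa using fun h => h2 w hw (sub_eq_zero.1 h)
    set b := closedDiskAlgebra.ofDiffContOnCl _ (diffContOnCl_rational (P := 1) hpole) with hb
    have hmem : hX.inclusion b ∈ diskRatElements X (n + 1) := by
      refine ⟨b.1, ⟨1, (Polynomial.X - C 2) ^ (n + 1), by simp, ?_, fun w => hpole w w.2,
        fun w => rfl⟩, fun w => rfl⟩
      rw [natDegree_pow, natDegree_X_sub_C, mul_one]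
    obtain ⟨g, hg, hbg⟩ := hsub hmem
    have hinf : ((Subtype.val : ClosedDisk → ℂ) '' (Subtype.val ⁻¹' OpenDisk)).Infinite := by
      rw [Subtype.image_preimage_coe, Set.inter_eq_self_of_subset_right
        Metric.ball_subset_closedBall]
      exact infinite_of_mem_nhds 0 (Metric.ball_mem_nhds 0 one_pos)
    obtain ⟨t, ht, hne⟩ := ne_of_mem_ratFunctions hinf (r := 1) (w := 2) (by simp)
      (fun w => h2 w w.2) n.lt_succ_self hg
    refine hne ?_
    have h3 := hbg ⟨t, ht⟩
    rw [hX.inclusion_apply, hb, closedDiskAlgebra.ofDiffContOnCl_apply] at h3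
    rw [← h3]
    simp
  add_subset := ⟨fun n => 2 * n, fun n => ⟨Nat.le_mul_of_pos_left n two_pos,
    fun x hx y hy => add_mem_diskRatElements hx hy⟩⟩
  smul_mem n c x hx := smul_mem_diskRatElements c hx
  dense x ε hε := by
    obtain ⟨C, hC0, hC⟩ := hX.exists_bound hp
    obtain ⟨η, hη, happrox⟩ :=
      exists_quasiNorm_sub_lt hX.quasiBanach.toIsQuasiNorm hC0 hC hε
    obtain ⟨y, ⟨F, hF, hy⟩, hxy⟩ := hX.diskAlgebra_dense x η hη
    set f := closedDiskAlgebra.ofDiffContOnCl F hF with hf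
    have hfy : hX.inclusion f = y := Subtype.ext (funext fun w => (hy w).symm)
    obtain ⟨Q, hQ⟩ := closedDiskAlgebra.exists_polynomial_near f hη
    set g := closedDiskAlgebra.ofDiffContOnCl _ Q.differentiable.diffContOnCl with hg
    refine ⟨Q.natDegree, hX.inclusion g, ⟨g.1, ⟨Q, 1, le_rfl, by simp, by simp, fun w => ?_⟩,
      fun w => rfl⟩, happrox x f (hfy ▸ hxy) g (closedDiskAlgebra.norm_le hη.le fun w => hQ w)⟩
    rw [eval_one, div_one]
    rfl

end Disk

end

theorem theorem6p9 (p : ℝ) (hp : 0 < p) :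
    -- (1) `R_n(I)` on a real interval
    (∀ (I : Set ℝ), I.OrdConnected → (interior I).Nonempty →
      ∀ (X : Submodule ℂ (I →ₘ[lebesgueOn I] ℂ)) (N : X → ℝ),
        IsBetweenC0AndLp (lebesgueOn I) p X N →
        IsApproximationScheme N (fun n => elementsIn X (ratFunctions (realCoord I) (n + 1))) ∧
        (¬ IsOpen I →
          IsApproximationScheme N (fun n => elementsIn X (ratFunctions (realCoord I) n))) ∧
        SatisfiesShapiro N (fun n => elementsIn X (ratFunctions (realCoord I) n))) ∧
    -- (2) `E_n(I)` on a real interval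
    (∀ (I : Set ℝ), I.OrdConnected → (interior I).Nonempty →
      ∀ (X : Submodule ℂ (I →ₘ[lebesgueOn I] ℂ)) (N : X → ℝ),
        IsBetweenC0AndLp (lebesgueOn I) p X N →
        ((∃ a : ℝ, I ⊆ Set.Icc a (a + 2 * Real.pi) ∧
          ∀ x : X, ∀ ε > 0, ∃ (f : ZeroAtInftyContinuousMap I ℂ) (y : X),
            Function.extend Subtype.val f 0 a =
              Function.extend Subtype.val f 0 (a + 2 * Real.pi) ∧
            (y : I →ₘ[lebesgueOn I] ℂ) =ᵐ[lebesgueOn I] f ∧ N (x - y) < ε) →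
          IsApproximationScheme N (fun n => elementsIn X (trigRatFunctions (realExp I) n))) ∧
        SatisfiesShapiro N (fun n => elementsIn X (trigRatFunctions (realExp I) n))) ∧
    -- (3) `E_n(𝕋)`
    (∀ (X : Submodule ℂ (AddCircle (2 * Real.pi) →ₘ[volume] ℂ)) (N : X → ℝ),
      IsBetweenC0AndLp volume p X N →
        IsApproximationScheme N (fun n => elementsIn X (trigRatFunctions torusExp n)) ∧
        SatisfiesShapiro N (fun n => elementsIn X (trigRatFunctions torusExp n))) ∧
    -- (4) `R_n(∂𝔻)`
    (∀ (X : Submodule ℂ (UnitCircle →ₘ[arcLength] ℂ)) (N : X → ℝ),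
      IsBetweenC0AndLp arcLength p X N →
        IsApproximationScheme N
          (fun n => elementsIn X (ratFunctions (Subtype.val : UnitCircle → ℂ) n)) ∧
        SatisfiesShapiro N
          (fun n => elementsIn X (ratFunctions (Subtype.val : UnitCircle → ℂ) n))) ∧
    -- (5) `R_n` of the closed unit disk
    (∀ (X : Submodule ℂ (OpenDisk → ℂ)) (N : X → ℝ), IsBetweenDiskAlgebraAndHp p X N →
        IsApproximationScheme N (diskRatElements X) ∧
        SatisfiesShapiro N (diskRatElements X)) := by

  have hfarI : ∀ (I : Set ℝ), I.OrdConnected → (interior I).Nonempty → ∀ z : ℝ → ℂ,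
      Continuous z → ((∀ t, (z t).im = 0) ∨ ∀ t, ‖z t‖ = 1) →
      (∀ u v, v - u ≤ 2 * Real.pi → Set.InjOn z (Set.Ioo u v)) →
      ∃ c > 0, ∀ n, ∃ f : ZeroAtInftyContinuousMap I ℂ, ‖f‖ ≤ 1 ∧
        ∀ g ∈ ratFunctions (fun t : I => z t) n,
          ENNReal.ofReal c ≤ eLpNorm (⇑f - g) (ENNReal.ofReal p) (lebesgueOn I) := by
    intro I hI hne z hz hz' hinj
    obtain ⟨u, v, huv, hvu, huvI⟩ := exists_Icc_subset_of_interior hne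
    have h0 : 0 < v - u := sub_pos.2 huv
    exact ⟨_, by positivity, exists_C0_far_of_interval hp hI huv huvI hz hz' (hinj u v hvu)⟩
  refine ⟨fun I hI hne X N hX => ?_, fun I hI hne X N hX => ?_, fun X N hX => ?_,
    fun X N hX => ?_, fun X N hX => ⟨hX.isApproximationScheme hp, hX.satisfiesShapiro hp⟩⟩
  · obtain ⟨hb, ha⟩ := hX.bounded hI hne hp
    obtain ⟨c, d, hcd, hI₁, hI₂⟩ := exists_endpoints hI hne hb ha
    have hnull : ∀ ζ, {t : ℝ | (t : ℂ) = ζ}.Countable := fun ζ =>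
      Set.Subsingleton.countable fun s hs t ht => Complex.ofReal_injective (hs.trans ht.symm)
    have hI' : ∀ t : ℝ, (t : ℂ) ≠ Complex.I := fun t h => by
      simpa using congrArg Complex.im h
    have hdense : ∀ x : X, ∀ ε > 0, ∃ (f : ZeroAtInftyContinuousMap I ℂ) (y : X),
        (y : I →ₘ[lebesgueOn I] ℂ) =ᵐ[lebesgueOn I] f ∧ N (x - y) < ε ∧
        ∀ δ > 0, ∃ g : ZeroAtInftyContinuousMap I ℂ, ‖f - g‖ ≤ δ ∧
          ∃ n, ⇑g ∈ ratFunctions (realCoord I) n := fun x ε hε => by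
      obtain ⟨f, y, hy, hxy⟩ := hX.C0_dense x ε hε
      exact ⟨f, y, hy, hxy, fun δ hδ => exists_C0_near_realCoord hcd hI₁ hI₂ f hδ⟩
    refine ⟨?_, fun hopen => ?_, ?_⟩
    · exact hX.isApproximationScheme_interval hcd hI₁ hI₂ hI hp Complex.continuous_ofReal hnull hI'
        (D := fun n => n + 1) (fun m n h => Nat.add_lt_add_right h 1)
        ⟨fun n => 2 * n + 1, fun n => ⟨by lia, by lia⟩⟩
        (fun n => Or.inl (by simp)) hdense
    · -- a bounded interval that is not open contains one of its end points
      have hmem : c ∈ I ∨ d ∈ I := by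
        by_contra! h
        refine hopen ?_
        rw [show I = Set.Ioo c d from Set.Subset.antisymm (fun t ht =>
          ⟨lt_of_le_of_ne (hI₂ ht).1 fun he => h.1 (he ▸ ht),
            lt_of_le_of_ne (hI₂ ht).2 fun he => h.2 (he ▸ ht)⟩) hI₁]
        exact isOpen_Ioo
      exact hX.isApproximationScheme_interval hcd hI₁ hI₂ hI hp Complex.continuous_ofReal hnull hI'
        (D := fun n => n) strictMono_id
        ⟨fun n => 2 * n, fun n => ⟨Nat.le_mul_of_pos_left n two_pos, le_rfl⟩⟩
        (fun n => Or.inr ⟨hmem, by simp⟩) hdense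
    · have := hX.satisfiesShapiro hp (hfarI I hI hne _ Complex.continuous_ofReal
        (Or.inl Complex.ofReal_im) fun u v _ => Complex.ofReal_injective.injOn) 1
      simp only [one_mul] at this
      exact this
  · have hE : ∀ n, trigRatFunctions (realExp I) n = ratFunctions (realExp I) (2 * n) :=
      trigRatFunctions_eq fun t => Complex.exp_ne_zero _
    simp only [hE]
    refine ⟨fun ⟨a, hIa, hdense⟩ => ?_, ?_⟩
    · obtain ⟨c, d, hcd, hI₁, hI₂⟩ := exists_endpoints hI hne (bddBelow_Icc.mono hIa)
        (bddAbove_Icc.mono hIa)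
      have hcdI : Set.Icc c d ⊆ Set.Icc a (a + 2 * Real.pi) := by
        rw [← closure_Ioo hcd.ne]
        exact closure_minimal (hI₁.trans hIa) isClosed_Icc
      have hac := (hcdI (Set.left_mem_Icc.2 hcd.le)).1
      have hda := (hcdI (Set.right_mem_Icc.2 hcd.le)).2
      refine hX.isApproximationScheme_interval hcd hI₁ hI₂ hI hp continuous_exp_I_mul
        countable_exp_I_mul_eq (w := 2) (fun t h => ?_) (D := fun n => 2 * n)
        (fun m n h => Nat.mul_lt_mul_of_pos_left h two_pos)
        ⟨fun n => 2 * n, fun n => ⟨Nat.le_mul_of_pos_left n two_pos, le_rfl⟩⟩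
        (fun n => Or.inl (by lia))
        fun x ε hε => ?_
      · have := norm_exp_I_mul t
        rw [h] at this
        norm_num at this
      · obtain ⟨f, y, hf, hy, hxy⟩ := hdense x ε hε
        exact ⟨f, y, hy, hxy, fun δ hδ => exists_C0_near_realExp hcd hI₁ hI₂ hac hda f hf hδ⟩
    · exact hX.satisfiesShapiro hp (hfarI I hI hne _ continuous_exp_I_mul
        (Or.inr norm_exp_I_mul) fun u v h => exp_I_mul_injOn h) 2
  · have hE : ∀ n, trigRatFunctions torusExp n = ratFunctions torusExp (2 * n) :=
      trigRatFunctions_eq torusExp_ne_zero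
    simp only [hE]
    exact IsBetweenC0AndLp.scheme_and_shapiro_of_circle continuous_torusExp
      (AddCircle.continuous_mk' _) map_coe_addCircle torusExp_coe norm_torusExp
      continuous_id Function.surjective_id (fun x => rfl) hX hp two_pos
  · have hmap : Measure.map (fun t : ℝ => torusToCircle (t : AddCircle (2 * Real.pi)))
        (volume.restrict (Set.Ioc 0 (2 * Real.pi))) = arcLength := by
      have hcoe : Continuous ((↑) : ℝ → AddCircle (2 * Real.pi)) := AddCircle.continuous_mk' _
      rw [arcLength, ← map_coe_addCircle,
        Measure.map_map continuous_torusToCircle.measurable hcoe.measurable]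
      rfl
    have := IsBetweenC0AndLp.scheme_and_shapiro_of_circle continuous_subtype_val
      (continuous_torusToCircle.comp (AddCircle.continuous_mk' _)) hmap torusExp_coe
      (fun x => mem_sphere_zero_iff_norm.1 x.2) continuous_torusToCircle
      surjective_torusToCircle (fun x => rfl) hX hp one_pos
    simp only [one_mul] at this
    exact this
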